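/- For a probability law $P$ on $\mathbb R$ with $\int|x|^3\,dP<\infty$ and standard deviation $\sigma(P)>0$, let $\mu(P)$ be its mean, let $\widetilde P$ be the image of $P$ under $x\mapsto (x-\mu(P))/\sigma(P)$, and let $\varrho(P)=\int\left|\frac{x-\mu(P)}{\sigma(P)}\right|^3dP(x)$. For $\varrho\ge 1$ put $B(\varrho)=\sqrt{\varrho^2/2+\varrho\sqrt{\varrho^2+8}/2-2}$. For probability laws $P,Q$ on $\mathbb R$ let $$\zeta_3(P,Q)=\sup_f\left|\int f\,dP-\int f\,dQ\right|\in[0,\infty],$$ the supremum being over all bounded $f\in C^2(\mathbb R,\mathbb R)$ with $|f''(x)-f''(y)|\le|x-y|$ for all $x,y\in\mathbb R$. Let $\mathrm N$ be the standard normal law and $\delta_a$ the point mass at $a$. **Theorem.** Let $n\ge1$ and let $P_1,\dots,P_n$ be probability laws on $\mathbb R$ with finite third absolute moments and with $\sigma_i=\sigma(P_i)>0$. Put $\varrho_i=\varrho(P_i)$, $\sigma=\left(\sum_{i=1}^n\sigma_i^2\right)^{1/2}$, $Q_i=\frac12(\delta_{-\sigma_i}+\delta_{\sigma_i})$, and denote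 by $P^{(n)}=P_1*\cdots*P_n$ and $Q^{(n)}=Q_1*\cdots*Q_n$ the convolutions. Then $$\zeta_3\left(\widetilde{P^{(n)}},\mathrm N\right)\le\frac1{6\sigma^3}\sum_{i=1}^n\sigma_i^3B(\varrho_i)+\zeta_3\left(\widetilde{Q^{(n)}},\mathrm N\right).$$ Further, if $\sigma_1\ge\sigma_2\ge\dots\ge\sigma_n$, then $$\zeta_3\left(\widetilde{Q^{(n)}},\mathrm N\right)\le\frac16\left(2\sqrt{\frac2\pi}-1\right)\frac{\sigma_1^3}{\sigma^3}+\frac1{6\sqrt{2\pi}}\sum_{k=1}^{n-1}\frac{\sigma_{k+1}^3\min\{1,\sqrt n\,\sigma_{k+1}/\sigma\}}{\sigma^3\sqrt k}\le 0.0993\,\frac{\sigma_1^3}{\sigma^3}+0.0665\sum_{k=1}^{n-1}\frac{\sigma_{k+1}^3}{\sigma^3\sqrt k}.$$ -/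

import Mathlib

open MeasureTheory ProbabilityTheory

namespace ZolotarevCLT

noncomputable section

/-- The mean of a law `P` on the real line. -/
def mean (P : Measure ℝ) : ℝ := ∫ x, x ∂P

/-- The standard deviation of a law `P` on the real line (used for laws with a finite
second moment). -/
def stdDev (P : Measure ℝ) : ℝ := √(variance (fun x : ℝ => x) P)

/-- The class of probability laws on the real line that have a finite third absolute moment and
are not concentrated at a single point. -/
structure NondegenerateL3 (P : Measure ℝ) : Prop where
  isProbabilityMeasure : IsProbabilityMeasure P
  integrable_abs_cube : Integrable (fun x : ℝ => |x| ^ 3) P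
  stdDev_pos : 0 < stdDev P

/-- The standardization of `P`: its image under `x ↦ (x - mean) / (standard deviation)`. -/
def standardize (P : Measure ℝ) : Measure ℝ :=
  P.map (fun x : ℝ => (x - mean P) / stdDev P)

/-- The standardized third absolute moment of `P`. -/
def rho (P : Measure ℝ) : ℝ := ∫ x, |(x - mean P) / stdDev P| ^ 3 ∂P

/-- The function `B`, used on `[1, ∞)`. -/
def B (ρ : ℝ) : ℝ := √(ρ ^ 2 / 2 + ρ * √(ρ ^ 2 + 8) / 2 - 2)

/-- The convolution `P 1 ∗ P 2 ∗ ⋯ ∗ P n`. -/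
def iterConv (P : ℕ → Measure ℝ) : ℕ → Measure ℝ
  | 0 => Measure.dirac 0
  | n + 1 => (iterConv P n).conv (P (n + 1))

/-- The symmetric two-point law `(δ_{-s} + δ_s) / 2`. -/
def symTwoPoint (s : ℝ) : Measure ℝ :=
  (2⁻¹ : ENNReal) • (Measure.dirac (-s) + Measure.dirac s)

/-- Bounded real functions of class `C²` on the line whose second derivative is Lipschitz with
constant at most `1`. -/
def boundedF3 : Set (ℝ → ℝ) :=
  {f | ContDiff ℝ 2 f ∧ LipschitzWith 1 (iteratedDeriv 2 f) ∧ ∃ M : ℝ, ∀ x, |f x| ≤ M}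

/-- The Zolotarev distance of order `3`; it may take the value `∞`. -/
def zeta3 (P Q : Measure ℝ) : ENNReal :=
  ⨆ f ∈ boundedF3, ENNReal.ofReal |∫ x, f x ∂P - ∫ x, f x ∂Q|

end

end ZolotarevCLT

namespace ZolotarevCLT

/-! ### Convexity facts for functions given with their derivatives -/

/-! `zeta3` contracts under convolution with a common law and is homogeneous of order 3 under
scaling. Lindeberg's replacement of one summand at a time therefore reduces the first inequality to
one standardized law `P` against `symTwoPoint 1`, with bound `B ρ / 6`.

For that comparison, each test function f lies below a function |x - h|³/6 + quadratic that touches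
it to first order at ±1, for some h in [-1, 1] depending on f (`exists_centered_cubic_majorant`).
The quadratic has the same integral under both laws. What remains is E|X - h|³ ≤ 1 + 3h² + B(ρ),
where 1 + 3h² is the value for the symmetric two-point law (`integral_abs_sub_cube_le`). Its proof
compares X with the standardized law on {c, -1/c}, where c² is the ratio of the second moments of
the positive and negative parts. A pointwise inequality tangent at c, together with Cauchy–Schwarz,
reduces everything to algebra in c, h and ρ.

For the second inequality the symmetric two-point laws are replaced in turn by normal laws of equal
variance. The first replacement is unsmoothed and uses the same majorant with h = 0, giving (E|Z|³ -
1)/6. In each later one the normal factors already inserted smooth the test function: Stein's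
identity gives its average a Lipschitz third derivative, and the matching third moments then yield a
fourth-order error (`zeta3_gaussian_smoothing_le`). The ordering of the variances bounds the
smoothing variance from below. -/

theorem exists_lt_of_second_deriv_neg {φ φ' ψ : ℝ → ℝ} (hφ : ∀ x, HasDerivAt φ (φ' x) x)
    (hφ' : ∀ x, HasDerivAt φ' (ψ x) x) (hψ : Continuous ψ) {a : ℝ} (h0 : φ' a = 0)
    (hneg : ψ a < 0) : ∃ δ > 0, ∀ x ∈ Set.Ico (a - δ) a, φ x < φ a := by
  obtain ⟨δ, hδ, hball⟩ := Metric.mem_nhds_iff.1 (hψ.continuousAt.eventually_lt continuousAt_const hneg)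
  refine ⟨δ / 2, by positivity, fun x hx => ?_⟩
  have hneg' : ∀ y ∈ Set.Icc (a - δ / 2) a, ψ y < 0 := fun y hy => by
    apply hball
    rw [Metric.mem_ball, Real.dist_eq, abs_lt]
    constructor <;> linarith [hy.1, hy.2]
  have hanti : StrictAntiOn φ' (Set.Icc (a - δ / 2) a) := by
    apply strictAntiOn_of_deriv_neg (convex_Icc _ _)
    · exact fun y _ => (hφ' y).continuousAt.continuousWithinAt
    · intro y hy
      rw [interior_Icc] at hy
      rw [(hφ' y).deriv]
      exact hneg' y ⟨hy.1.le, hy.2.le⟩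
  have hmono : StrictMonoOn φ (Set.Icc (a - δ / 2) a) := by
    apply strictMonoOn_of_deriv_pos (convex_Icc _ _)
    · exact fun y _ => (hφ y).continuousAt.continuousWithinAt
    · intro y hy
      rw [interior_Icc] at hy
      rw [(hφ y).deriv, ← h0]
      exact hanti ⟨hy.1.le, hy.2.le⟩ (Set.right_mem_Icc.2 (by linarith)) hy.2
  exact hmono ⟨hx.1, hx.2.le⟩ (Set.right_mem_Icc.2 (by linarith)) hx.2

theorem nonneg_right_of_second_deriv_nonneg {φ φ' ψ : ℝ → ℝ} (hφ : ∀ x, HasDerivAt φ (φ' x) x)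
    (hφ' : ∀ x, HasDerivAt φ' (ψ x) x) {a b : ℝ} (hab : a ≤ b) (h0 : 0 ≤ φ a) (h0' : 0 ≤ φ' a)
    (hψ : ∀ x ∈ Set.Icc a b, 0 ≤ ψ x) : 0 ≤ φ b := by
  have hmono' : MonotoneOn φ' (Set.Icc a b) := by
    apply monotoneOn_of_deriv_nonneg (convex_Icc _ _)
    · exact fun y _ => (hφ' y).continuousAt.continuousWithinAt
    · exact fun y _ => (hφ' y).differentiableAt.differentiableWithinAt
    · intro y hy
      rw [(hφ' y).deriv]
      exact hψ y (interior_subset hy)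
  have hmono : MonotoneOn φ (Set.Icc a b) := by
    apply monotoneOn_of_deriv_nonneg (convex_Icc _ _)
    · exact fun y _ => (hφ y).continuousAt.continuousWithinAt
    · exact fun y _ => (hφ y).differentiableAt.differentiableWithinAt
    · intro y hy
      rw [(hφ y).deriv]
      exact h0'.trans (hmono' (Set.left_mem_Icc.2 hab) (interior_subset hy) (interior_subset hy).1)
  exact h0.trans (hmono (Set.left_mem_Icc.2 hab) (Set.right_mem_Icc.2 hab) hab)

theorem hasDerivAt_comp_neg {φ : ℝ → ℝ} {d x : ℝ} (h : HasDerivAt φ d (-x)) :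
    HasDerivAt (fun y => φ (-y)) (-d) x := by
  exact (h.comp x (hasDerivAt_neg x)).congr_deriv (by ring)

theorem nonneg_left_of_second_deriv_nonneg {φ φ' ψ : ℝ → ℝ} (hφ : ∀ x, HasDerivAt φ (φ' x) x)
    (hφ' : ∀ x, HasDerivAt φ' (ψ x) x) {a b : ℝ} (hab : a ≤ b) (h0 : 0 ≤ φ b) (h0' : φ' b ≤ 0)
    (hψ : ∀ x ∈ Set.Icc a b, 0 ≤ ψ x) : 0 ≤ φ a := by
  have := nonneg_right_of_second_deriv_nonneg (φ := fun x => φ (-x)) (φ' := fun x => -φ' (-x))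
    (ψ := fun x => ψ (-x)) (a := -b) (b := -a) (fun x => hasDerivAt_comp_neg (hφ _))
    (fun x => (hasDerivAt_comp_neg (hφ' (-x))).fun_neg.congr_deriv (neg_neg _)) (by linarith) (by simpa)
    (by simpa) (fun x hx => hψ _ ⟨by linarith [hx.2], by linarith [hx.1]⟩)
  simpa using this

/-- A function with double zeros at `±1` whose second derivative first decreases and then increases
is nonnegative. -/
theorem nonneg_of_double_zeros {φ φ' ψ : ℝ → ℝ} (hφ : ∀ x, HasDerivAt φ (φ' x) x)
    (hφ' : ∀ x, HasDerivAt φ' (ψ x) x) (hψ : Continuous ψ) {h : ℝ} (hh : h ∈ Set.Icc (-1 : ℝ) 1)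
    (hanti : AntitoneOn ψ (Set.Iic h)) (hmono : MonotoneOn ψ (Set.Ici h))
    (h1 : φ 1 = 0) (h2 : φ (-1) = 0) (h3 : φ' 1 = 0) (h4 : φ' (-1) = 0) (x : ℝ) : 0 ≤ φ x := by
  have key : ∀ x ∈ Set.Icc (-1 : ℝ) 1, 0 ≤ φ x := by
    obtain ⟨z, hz, hmin⟩ := isCompact_Icc.exists_isMinOn (Set.nonempty_Icc.2 (by norm_num))
      (fun y _ => (hφ y).continuousAt.continuousWithinAt : ContinuousOn φ (Set.Icc (-1 : ℝ) 1))
    suffices 0 ≤ φ z from fun x hx => this.trans (hmin hx)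
    by_contra! hlt
    have hz1 : z < 1 := lt_of_le_of_ne hz.2 (fun e => by subst e; linarith)
    have hz2 : -1 < z := lt_of_le_of_ne hz.1 (fun e => by subst e; linarith)
    have hd : φ' z = 0 := IsLocalMin.hasDerivAt_eq_zero
      (hmin.isLocalMin (Icc_mem_nhds hz2 hz1)) (hφ z)
    have hψz : 0 ≤ ψ z := by
      by_contra! hneg
      obtain ⟨δ, hδ, H⟩ := exists_lt_of_second_deriv_neg hφ hφ' hψ hd hneg
      have hm := H (max (z - δ) (-1)) ⟨le_max_left _ _, max_lt (by linarith) hz2⟩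
      have := hmin (show max (z - δ) (-1) ∈ Set.Icc (-1 : ℝ) 1 from
        ⟨le_max_right _ _, (max_lt (by linarith) hz2).le.trans hz1.le⟩)
      simp only [Set.mem_ofPred_eq] at this
      linarith
    -- Moving away from `h`, `ψ` only grows, so `0 ≤ ψ z` persists up to the endpoint on the side of
    -- `z`. There `φ` is convex and starts from a double zero, so it cannot be negative at `z`.
    rcases le_total z h with hc | hc
    · refine hlt.not_ge (nonneg_right_of_second_deriv_nonneg hφ hφ' hz2.le h2.ge h4.ge ?_)
      exact fun y hy => hψz.trans (hanti (hy.2.trans hc) hc hy.2)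
    · refine hlt.not_ge (nonneg_left_of_second_deriv_nonneg hφ hφ' hz1.le h1.ge h3.le ?_)
      exact fun y hy => hψz.trans (hmono hc (hc.trans hy.1) hy.1)
  -- Since `φ` is nonnegative inside and has a double zero at 1, a negative `ψ 1` would contradict
  -- `key`. This sign, and its mirror image at -1, make `φ` convex outside `[-1, 1]`.
  have hp : 0 ≤ ψ 1 := by
    by_contra! hneg
    obtain ⟨δ, hδ, H⟩ := exists_lt_of_second_deriv_neg hφ hφ' hψ h3 hneg
    have hm := H (max (1 - δ) (-1)) ⟨le_max_left _ _, max_lt (by linarith) (by norm_num)⟩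
    have := key (max (1 - δ) (-1)) ⟨le_max_right _ _, max_le (by linarith) (by norm_num)⟩
    linarith
  have hn : 0 ≤ ψ (-1) := by
    by_contra! hneg
    obtain ⟨δ, hδ, H⟩ := exists_lt_of_second_deriv_neg (φ := fun x => φ (-x))
      (φ' := fun x => -φ' (-x)) (ψ := fun x => ψ (-x)) (a := 1)
      (fun x => hasDerivAt_comp_neg (hφ _))
      (fun x => (hasDerivAt_comp_neg (hφ' (-x))).fun_neg.congr_deriv (neg_neg _)) (by fun_prop) (by simpa) hneg
    have hm := H (max (1 - δ) (-1)) ⟨le_max_left _ _, max_lt (by linarith) (by norm_num)⟩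
    have := key (-max (1 - δ) (-1))
      ⟨neg_le_neg (max_le (by linarith) (by norm_num)), by linarith [le_max_right (1 - δ) (-1)]⟩
    linarith
  rcases le_total x (-1) with hx | hx
  · refine nonneg_left_of_second_deriv_nonneg hφ hφ' hx h2.ge h4.le ?_
    exact fun y hy => hn.trans (hanti (hy.2.trans hh.1) hh.1 hy.2)
  rcases le_total x 1 with hx' | hx'
  · exact key x ⟨hx, hx'⟩
  · refine nonneg_right_of_second_deriv_nonneg hφ hφ' hx' h1.ge h3.ge ?_
    exact fun y hy => hp.trans (hmono hh.2 (hh.2.trans hy.1) hy.1)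

/-! ### Cubic majorants of functions with Lipschitz second derivative -/

theorem hasDerivAt_mul_abs (x : ℝ) : HasDerivAt (fun y : ℝ => y * |y|) (2 * |x|) x := by
  rcases lt_trichotomy x 0 with hx | rfl | hx
  · rw [abs_of_neg hx]
    have : HasDerivAt (fun y : ℝ => -(y ^ 2)) (2 * -x) x :=
      ((hasDerivAt_pow 2 x).neg).congr_deriv (by push_cast; ring)
    refine this.congr_of_eventuallyEq ?_
    filter_upwards [Iio_mem_nhds hx] with y hy
    rw [abs_of_neg hy]; ring
  · rw [hasDerivAt_iff_isLittleO_nhds_zero]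
    simp only [zero_add, abs_zero, mul_zero, smul_eq_mul, sub_zero]
    have h1 : (fun y : ℝ => |y|) =o[nhds 0] (fun _ => (1 : ℝ)) := by
      rw [Asymptotics.isLittleO_one_iff]
      simpa using (continuous_abs.tendsto (0 : ℝ))
    simpa using (Asymptotics.isBigO_refl (fun y : ℝ => y) (nhds 0)).mul_isLittleO h1
  · rw [abs_of_pos hx]
    have : HasDerivAt (fun y : ℝ => y ^ 2) (2 * x) x :=
      (hasDerivAt_pow 2 x).congr_deriv (by push_cast; ring)
    refine this.congr_of_eventuallyEq ?_
    filter_upwards [Ioi_mem_nhds hx] with y hy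
    rw [abs_of_pos hy]; ring

theorem hasDerivAt_abs_cube (x : ℝ) : HasDerivAt (fun y : ℝ => |y| ^ 3) (3 * (x * |x|)) x := by
  have h := (hasDerivAt_id x).mul (hasDerivAt_mul_abs x)
  have e : (fun y : ℝ => |y| ^ 3) = fun y => id y * (y * |y|) := by
    ext y
    rw [id, ← mul_assoc, ← sq, ← sq_abs]; ring
  rw [e]
  exact h.congr_deriv (by simp only [id]; ring)

/-- The coefficients α, β, κ meet three of the four contact conditions at ±1. The functional in `hT`
vanishes on quadratics and equals h³/3 - h on |x - h|³/6, so `hT` is exactly the fourth. The gap has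
second derivative |x - h| + 2α - f'', monotone on either side of h because f'' is 1-Lipschitz. The
last identity evaluates the majorant at the contact points. -/
theorem exists_cubic_majorant {f f' f'' : ℝ → ℝ} (hf : ∀ x, HasDerivAt f (f' x) x)
    (hf' : ∀ x, HasDerivAt f' (f'' x) x) (hL : LipschitzWith 1 f'') {h : ℝ}
    (hh : h ∈ Set.Icc (-1 : ℝ) 1)
    (hT : f' 1 + f' (-1) - (f 1 - f (-1)) = h ^ 3 / 3 - h) :
    ∃ α β κ : ℝ, (∀ x, f x ≤ |x - h| ^ 3 / 6 + (κ + β * x + α * x ^ 2)) ∧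
      (f 1 + f (-1)) / 2 = (1 + 3 * h ^ 2) / 6 + κ + α := by
  set g : ℝ → ℝ := fun x => |x - h| ^ 3 / 6 with hg
  have hgd : ∀ x, HasDerivAt g ((x - h) * |x - h| / 2) x := fun x =>
    (((hasDerivAt_abs_cube (x - h)).comp_sub_const x h).div_const 6).congr_deriv (by ring)
  have hgd' : ∀ x, HasDerivAt (fun x => (x - h) * |x - h| / 2) |x - h| x := fun x =>
    (((hasDerivAt_mul_abs (x - h)).comp_sub_const x h).div_const 2).congr_deriv (by ring)
  have e1 : |1 - h| = 1 - h := abs_of_nonneg (by linarith [hh.2])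
  have e2 : |-1 - h| = 1 + h := by rw [abs_of_nonpos (by linarith [hh.1])]; ring
  have g1 : g 1 = (1 - h) ^ 3 / 6 := by rw [hg]; simp only [e1]
  have g2 : g (-1) = (1 + h) ^ 3 / 6 := by rw [hg]; simp only [e2]
  set α := (f' 1 - f' (-1) - ((1 - h) ^ 2 + (1 + h) ^ 2) / 2) / 4 with hα
  set β := (f 1 - f (-1) - (g 1 - g (-1))) / 2 with hβ
  set κ := (f 1 + f (-1)) / 2 - (1 + 3 * h ^ 2) / 6 - α with hκ
  refine ⟨α, β, κ, fun x => ?_, by rw [hκ]; ring⟩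
  have hpos := nonneg_of_double_zeros (φ := fun x => g x + (κ + β * x + α * x ^ 2) - f x)
    (φ' := fun x => (x - h) * |x - h| / 2 + (β + 2 * α * x) - f' x)
    (ψ := fun x => |x - h| + 2 * α - f'' x) (h := h)
    (fun x => by
      have h1 : HasDerivAt (fun x : ℝ => κ + β * x + α * x ^ 2) (β + 2 * α * x) x := by
        have := (((hasDerivAt_id x).const_mul β).const_add κ).add
          ((hasDerivAt_pow 2 x).const_mul α)
        exact this.congr_deriv (by push_cast; ring)
      exact ((hgd x).add h1).sub (hf x))
    (fun x => by
      have h1 : HasDerivAt (fun x : ℝ => β + 2 * α * x) (2 * α) x := by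
        simpa using ((hasDerivAt_id x).const_mul (2 * α)).const_add β
      exact ((hgd' x).add h1).sub (hf' x))
    (by have := hL.continuous; fun_prop) hh
    (fun x hx y hy hxy => by
      have := hL.dist_le_mul x y
      simp only [Real.dist_eq, NNReal.coe_one, one_mul, Set.mem_Iic] at *
      rw [abs_of_nonpos (by linarith : x - h ≤ 0), abs_of_nonpos (by linarith : y - h ≤ 0)]
      rw [abs_of_nonpos (by linarith : x - y ≤ 0)] at this
      linarith [abs_le.1 this])
    (fun x hx y hy hxy => by
      have := hL.dist_le_mul x y
      simp only [Real.dist_eq, NNReal.coe_one, one_mul, Set.mem_Ici] at *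
      rw [abs_of_nonneg (by linarith : 0 ≤ x - h), abs_of_nonneg (by linarith : 0 ≤ y - h)]
      rw [abs_of_nonpos (by linarith : x - y ≤ 0)] at this
      linarith [abs_le.1 this])
    (by rw [g1, hκ, hβ, g1, g2]; ring) (by rw [g2, hκ, hβ, g1, g2]; ring)
    (by rw [e1, hα, hβ, g1, g2]; linarith) (by rw [e2, hα, hβ, g1, g2]; linarith) x
  have hgx : g x = |x - h| ^ 3 / 6 := rfl
  linarith

/-- On the interval [-t, t] the corresponding defect has t-derivative t(f''(t) - f''(-t)), of
absolute value at most 2t²; integrate from 0 to 1. -/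
theorem abs_hermite_defect_le {f f' f'' : ℝ → ℝ} (hf : ∀ x, HasDerivAt f (f' x) x)
    (hf' : ∀ x, HasDerivAt f' (f'' x) x) (hL : LipschitzWith 1 f'') :
    |f' 1 + f' (-1) - (f 1 - f (-1))| ≤ 2 / 3 := by
  have hd : ∀ t, HasDerivAt (fun t => t * (f' t + f' (-t)) - (f t - f (-t)))
      (t * (f'' t - f'' (-t))) t := fun t => by
    have := ((hasDerivAt_id t).mul ((hf' t).add (hasDerivAt_comp_neg (hf' (-t))))).sub
      ((hf t).sub (hasDerivAt_comp_neg (hf (-t))))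
    exact this.congr_deriv (by simp only [id, Pi.add_apply]; ring)
  have hc : ∀ t : ℝ, HasDerivAt (fun t : ℝ => 2 / 3 * t ^ 3) (2 * t ^ 2) t := fun t =>
    ((hasDerivAt_pow 3 t).const_mul (2 / 3)).congr_deriv (by push_cast; ring)
  have hb : ∀ t : ℝ, 0 ≤ t → |f'' t - f'' (-t)| ≤ 2 * t := fun t ht => by
    have := hL.dist_le_mul t (-t)
    simp only [Real.dist_eq, NNReal.coe_one, one_mul] at this
    rwa [sub_neg_eq_add, ← two_mul, abs_of_nonneg (by linarith : 0 ≤ 2 * t)] at this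
  rw [abs_le]
  constructor
  · have hm : MonotoneOn (fun t => t * (f' t + f' (-t)) - (f t - f (-t)) + 2 / 3 * t ^ 3)
        (Set.Icc 0 1) := by
      apply monotoneOn_of_deriv_nonneg (convex_Icc _ _)
      · exact fun y _ => ((hd y).add (hc y)).continuousAt.continuousWithinAt
      · exact fun y _ => ((hd y).add (hc y)).differentiableAt.differentiableWithinAt
      · intro t ht
        have ht := (interior_subset ht).1
        rw [((hd t).fun_add (hc t)).deriv]
        nlinarith [abs_le.1 (hb t ht)]
    have := hm (Set.left_mem_Icc.2 zero_le_one) (Set.right_mem_Icc.2 zero_le_one) zero_le_one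
    norm_num at this ⊢
    linarith
  · have hm : AntitoneOn (fun t => t * (f' t + f' (-t)) - (f t - f (-t)) - 2 / 3 * t ^ 3)
        (Set.Icc 0 1) := by
      apply antitoneOn_of_deriv_nonpos (convex_Icc _ _)
      · exact fun y _ => ((hd y).sub (hc y)).continuousAt.continuousWithinAt
      · exact fun y _ => ((hd y).sub (hc y)).differentiableAt.differentiableWithinAt
      · intro t ht
        have ht := (interior_subset ht).1
        rw [((hd t).fun_sub (hc t)).deriv]
        nlinarith [abs_le.1 (hb t ht)]
    have := hm (Set.left_mem_Icc.2 zero_le_one) (Set.right_mem_Icc.2 zero_le_one) zero_le_one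
    norm_num at this ⊢
    linarith

/-- The map h ↦ h³/3 - h takes [-1, 1] onto [-2/3, 2/3], exactly the range allowed for the defect.
-/
theorem exists_centered_cubic_majorant {f f' f'' : ℝ → ℝ} (hf : ∀ x, HasDerivAt f (f' x) x)
    (hf' : ∀ x, HasDerivAt f' (f'' x) x) (hL : LipschitzWith 1 f'') :
    ∃ h ∈ Set.Icc (-1 : ℝ) 1, ∃ α β κ : ℝ,
      (∀ x, f x ≤ |x - h| ^ 3 / 6 + (κ + β * x + α * x ^ 2)) ∧
      (f 1 + f (-1)) / 2 = (1 + 3 * h ^ 2) / 6 + κ + α := by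
  have hb := abs_le.1 (abs_hermite_defect_le hf hf' hL)
  obtain ⟨h, hh, he⟩ := intermediate_value_Icc' (show (-1 : ℝ) ≤ 1 by norm_num)
    (f := fun h : ℝ => h ^ 3 / 3 - h) (by fun_prop)
    (show f' 1 + f' (-1) - (f 1 - f (-1)) ∈ _ from ⟨by norm_num; linarith, by norm_num; linarith⟩)
  exact ⟨h, hh, exists_cubic_majorant hf hf' hL hh he.symm⟩

/-! ### A sharp bound for the shifted absolute third moment -/

theorem B_nonneg (ρ : ℝ) : 0 ≤ B ρ := Real.sqrt_nonneg _

/-- The lower bound for ρ is the third absolute moment of the standardized law on {c, -1/c}. With δ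
= 2c³v, clearing the two square roots turns the claim into a cubic inequality in ρ. -/
theorem sub_le_B {c v ρ : ℝ} (hc : 0 < c) (hc1 : c ≤ 1) (hv : (1 + c ^ 2) * v = 1)
    (hρ : v * (c ^ 4 + 1) / c ≤ ρ) : ρ - 2 * c ^ 3 * v ≤ B ρ := by
  have hv0 : 0 < v := by
    by_contra! h
    nlinarith [sq_nonneg c, mul_nonneg (by positivity : 0 ≤ 1 + c ^ 2) (neg_nonneg.2 h)]
  have hve : v = 1 / (1 + c ^ 2) := by
    field_simp
    linarith
  set r := v * (c ^ 4 + 1) / c with hr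
  obtain ⟨δ, hδ⟩ : ∃ δ, δ = 2 * c ^ 3 * v := ⟨_, rfl⟩
  rw [← hδ]
  have hδ0 : 0 < δ := hδ ▸ by positivity
  have hr0 : 0 < r := by positivity
  have hδ1 : δ ≤ 1 := by
    rw [hδ, hve, mul_one_div, div_le_one (by positivity)]
    nlinarith [sq_nonneg c, mul_nonneg hc.le (sq_nonneg c)]
  -- The two-point value r is a root of that cubic; the remaining factor is positive because δ ≤ 1.
  have hroot : 2 * δ * r ^ 3 - 5 * δ ^ 2 * r ^ 2 + 4 * δ * (δ ^ 2 + 2) * r - (δ ^ 2 + 2) ^ 2 = 0 := by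
    rw [hr, hδ, hve]
    field_simp
    ring
  have hcub : 0 ≤ 2 * δ * ρ ^ 3 - 5 * δ ^ 2 * ρ ^ 2 + 4 * δ * (δ ^ 2 + 2) * ρ - (δ ^ 2 + 2) ^ 2 := by
    have hfac : 2 * δ * ρ ^ 3 - 5 * δ ^ 2 * ρ ^ 2 + 4 * δ * (δ ^ 2 + 2) * ρ - (δ ^ 2 + 2) ^ 2
        = δ * ((ρ - r) * (2 * (ρ ^ 2 + ρ * r + r ^ 2) - 5 * δ * (ρ + r) + 4 * (δ ^ 2 + 2))) := by
      linear_combination hroot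
    rw [hfac]
    have : 0 ≤ 2 * (ρ ^ 2 + ρ * r + r ^ 2) - 5 * δ * (ρ + r) + 4 * (δ ^ 2 + 2) := by
      nlinarith [sq_nonneg (ρ - r), sq_nonneg (6 * (ρ + r) - 10 * δ)]
    exact mul_nonneg hδ0.le (mul_nonneg (by linarith) this)
  have hρ0 : 0 < ρ := by linarith
  set S := √(ρ ^ 2 + 8) with hS
  have hS2 : S ^ 2 = ρ ^ 2 + 8 := Real.sq_sqrt (by positivity)
  have hS0 : 0 ≤ S := Real.sqrt_nonneg _
  apply Real.le_sqrt_of_sq_le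
  have : ρ ^ 2 - 4 * ρ * δ + 2 * δ ^ 2 + 4 ≤ ρ * S := by
    apply le_of_sq_le_sq _ (by positivity)
    rw [mul_pow, hS2]
    nlinarith
  nlinarith

/-- Without the subtracted term this is an equality for x ≤ 0, with gap 2x³ on [0, h] and 6hx² -
6h²x + 2h³ beyond. The subtracted term is the combination of x² and x tangent to this gap at x = c;
on [0, h] the slack is 2x(x - c)². -/
theorem abs_sub_cube_le_of_le {c h : ℝ} (hc : 0 < c) (hch : c ≤ h) (x : ℝ) :
    |x - h| ^ 3 ≤ |x| ^ 3 + 3 * h * x ^ 2 - 3 * h ^ 2 * x + h ^ 3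
      - (4 * c * max x 0 ^ 2 - 2 * c ^ 2 * max x 0) := by
  rcases le_total x 0 with hx | hx
  · rw [max_eq_right hx, abs_of_nonpos hx, abs_of_nonpos (by linarith)]
    nlinarith
  rw [max_eq_left hx, abs_of_nonneg hx]
  rcases le_total x h with hxh | hxh
  · rw [abs_of_nonpos (by linarith)]
    nlinarith [mul_nonneg hx (sq_nonneg (x - c))]
  · rw [abs_of_nonneg (by linarith)]
    nlinarith [mul_nonneg hc.le (sq_nonneg (x - h)), mul_nonneg (sub_nonneg.2 hch) (sq_nonneg (x - h)),
      mul_nonneg hx (mul_nonneg (sub_nonneg.2 hch) (sub_nonneg.2 hxh)),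
      mul_nonneg hx (sq_nonneg (h - c))]

/-- The same tangent construction when the contact point c lies on the branch x ≥ h of the gap. -/
theorem abs_sub_cube_le_of_ge {c h : ℝ} (hh : 0 ≤ h) (hc : 0 < c) (hch : h ≤ c) (x : ℝ) :
    |x - h| ^ 3 ≤ |x| ^ 3 + 3 * h * x ^ 2 - 3 * h ^ 2 * x + h ^ 3
      - ((6 * h - 2 * h ^ 3 / c ^ 2) * max x 0 ^ 2 - (6 * h ^ 2 - 4 * h ^ 3 / c) * max x 0) := by
  rcases le_total x 0 with hx | hx
  · rw [max_eq_right hx, abs_of_nonpos hx, abs_of_nonpos (by linarith)]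
    nlinarith
  rw [max_eq_left hx, abs_of_nonneg hx]
  obtain ⟨r, hr⟩ : ∃ r, r = h / c := ⟨_, rfl⟩
  have e1 : h ^ 3 / c ^ 2 = h * r ^ 2 := by rw [hr]; field_simp
  have e2 : h ^ 3 / c = h ^ 2 * r := by rw [hr]; field_simp
  rw [mul_div_assoc, mul_div_assoc, e1, e2]
  have hr0 : 0 ≤ r := hr ▸ by positivity
  have hr1 : r ≤ 1 := hr ▸ (div_le_one hc).2 hch
  rcases le_total x h with hxh | hxh
  · rw [abs_of_nonpos (by linarith)]
    have key : 0 ≤ x ^ 2 - 3 * h * x + 3 * h ^ 2 - 2 * h ^ 2 * r + r ^ 2 * h * x := by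
      have : x ^ 2 - 3 * h * x + 3 * h ^ 2 - 2 * h ^ 2 * r + r ^ 2 * h * x
        = (x - h) ^ 2 + h * (1 - r) * ((h - x) + (h - r * x)) := by ring
      rw [this]
      have : r * x ≤ h := by nlinarith
      have := mul_nonneg (mul_nonneg hh (sub_nonneg.2 hr1)) (by linarith : 0 ≤ (h - x) + (h - r * x))
      positivity
    nlinarith [mul_nonneg hx key]
  · rw [abs_of_nonneg (by linarith)]
    nlinarith [mul_nonneg hh (sq_nonneg (h - r * x))]

/-- Here w is the gap at the contact point c. As 1 - 3h + 3h² - h³ = (1 - h)³, the claim says ρ -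
B(ρ) ≤ (1 - h)³ + vw. For c ≤ 1 it is compared with `sub_le_B` at c, for c ≥ 1 with `sub_le_B` at 1,
which gives ρ - B(ρ) ≤ 1. -/
theorem shift_gap_le {c h v ρ : ℝ} (hc : 0 < c) (hh : 0 ≤ h) (hh1 : h ≤ 1)
    (hv : (1 + c ^ 2) * v = 1) (hρ : v * (c ^ 4 + 1) / c ≤ ρ) {w : ℝ}
    (hw : w = if c ≤ h then 2 * c ^ 3 else 6 * h * c ^ 2 - 6 * h ^ 2 * c + 2 * h ^ 3) :
    ρ + 3 * h + h ^ 3 - v * w ≤ 1 + 3 * h ^ 2 + B ρ := by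
  have hv0 : 0 < v := by
    by_contra! h
    nlinarith [sq_nonneg c, mul_nonneg (by positivity : 0 ≤ 1 + c ^ 2) (neg_nonneg.2 h)]
  rcases le_total c 1 with hc1 | hc1
  · have hB := sub_le_B hc hc1 hv hρ
    split_ifs at hw with hch
    · have : 0 ≤ (1 - h) ^ 3 := pow_nonneg (by linarith) 3
      rw [hw]; nlinarith
    -- In this case w = 2c³ - 2(c - h)³, so the loss 2v(c - h)³ must be absorbed by (1 - h)³.
    · have h1 : (c - h) ^ 3 ≤ (c * (1 - h)) ^ 3 :=
        pow_le_pow_left₀ (by linarith) (by nlinarith) 3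
      have h2 : 2 * c ^ 3 * v ≤ 1 := by
        rw [← hv]
        have : 2 * c ^ 3 ≤ 1 + c ^ 2 := by nlinarith [sq_nonneg c, mul_nonneg hc.le (sq_nonneg c)]
        nlinarith
      have h3 : 0 ≤ (1 - h) ^ 3 := pow_nonneg (by linarith) 3
      have h4 : 2 * v * (c - h) ^ 3 ≤ (1 - h) ^ 3 := by
        calc 2 * v * (c - h) ^ 3 ≤ 2 * v * (c * (1 - h)) ^ 3 := by gcongr
          _ = 2 * c ^ 3 * v * (1 - h) ^ 3 := by ring
          _ ≤ 1 * (1 - h) ^ 3 := by gcongr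
          _ = _ := one_mul _
      rw [hw]; nlinarith
  · have hρ1 : 1 ≤ ρ := by
      refine le_trans ?_ hρ
      rw [le_div_iff₀ hc, one_mul]
      have : c * ((1 + c ^ 2) * v) ≤ v * (c ^ 4 + 1) := by
        have : 0 ≤ (c ^ 3 - 1) * (c - 1) := mul_nonneg (by nlinarith [one_le_pow₀ (n := 3) hc1]) (by linarith)
        nlinarith
      rwa [hv, mul_one] at this
    have hB := sub_le_B (c := 1) (v := 1 / 2) (ρ := ρ) one_pos le_rfl (by norm_num) (by norm_num; exact hρ1)
    norm_num at hB
    have hw' : w = 6 * h * c ^ 2 - 6 * h ^ 2 * c + 2 * h ^ 3 := by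
      rw [hw]
      split_ifs with hch
      · have e1 : c = 1 := le_antisymm (hch.trans hh1) hc1
        have e2 : h = 1 := le_antisymm hh1 (e1 ▸ hch)
        rw [e1, e2]; norm_num
      · rfl
    suffices 1 - (1 - h) ^ 3 ≤ v * w by nlinarith
    have hq : (3 - 3 * h + h ^ 2) * (1 + c ^ 2) ≤ 2 * (3 * c ^ 2 - 3 * h * c + h ^ 2) := by
      nlinarith [mul_nonneg (sub_nonneg.2 hc1) (sub_nonneg.2 hh1), mul_nonneg hh (sub_nonneg.2 hc1),
        mul_nonneg (mul_nonneg hh (sub_nonneg.2 hh1)) (sub_nonneg.2 hc1), sq_nonneg (c - 1),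
        mul_nonneg (mul_nonneg hh (sub_nonneg.2 hh1)) (sq_nonneg (c - 1))]
    have h5 : 1 - (1 - h) ^ 3 = v * (h * ((3 - 3 * h + h ^ 2) * (1 + c ^ 2))) := by
      linear_combination (-h * (3 - 3 * h + h ^ 2)) * hv
    rw [h5, hw']
    have := mul_le_mul_of_nonneg_left (mul_le_mul_of_nonneg_left hq hh) hv0.le
    linarith

theorem exists_twoPoint_parameter {m u v C D : ℝ} (hm : 0 ≤ m) (hu : 0 ≤ u) (hv : 0 ≤ v)
    (huv : u + v = 1) (hC : ∀ t, 0 ≤ C - 2 * t * u + t ^ 2 * m)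
    (hD : ∀ t, 0 ≤ D - 2 * t * v + t ^ 2 * m)
    (hS : ∀ α β, 2 * α * m - α ^ 2 * u + 2 * β * m - β ^ 2 * v ≤ 1) :
    ∃ c > 0, (1 + c ^ 2) * v = 1 ∧ u = c ^ 2 * v ∧ m ≤ c * v ∧ v * (c ^ 4 + 1) / c ≤ C + D := by
  have hm0 : 0 < m := by
    refine lt_of_le_of_ne hm fun e => ?_
    have h1 : u = 0 := by
      refine le_antisymm ?_ hu
      by_contra! hu'
      have := hC ((C + 1) / u)
      have h' : (C + 1) / u * u = C + 1 := div_mul_cancel₀ _ (ne_of_gt hu')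
      rw [← e] at this
      linarith [hC 0]
    have h2 : v = 0 := by
      refine le_antisymm ?_ hv
      by_contra! hv'
      have := hD ((D + 1) / v)
      have h' : (D + 1) / v * v = D + 1 := div_mul_cancel₀ _ (ne_of_gt hv')
      rw [← e] at this
      linarith [hD 0]
    linarith
  have hu0 : 0 < u := by
    refine lt_of_le_of_ne hu fun e => ?_
    have := hS (1 / m) 0
    rw [← e] at this
    field_simp at this
    linarith [pow_pos hm0 2]
  have hv0 : 0 < v := by
    refine lt_of_le_of_ne hv fun e => ?_
    have := hS 0 (1 / m)
    rw [← e] at this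
    field_simp at this
    linarith [pow_pos hm0 2]
  have hmuv : m ^ 2 ≤ u * v := by
    have h1 := hS (m / u) (m / v)
    have h2 : 2 * (m / u) * m - (m / u) ^ 2 * u + 2 * (m / v) * m - (m / v) ^ 2 * v
        = m ^ 2 / (u * v) := by
      have : m ^ 2 / (u * v) = m ^ 2 * (u + v) / (u * v) := by rw [huv, mul_one]
      rw [this]
      field_simp
      ring
    rwa [h2, div_le_one (by positivity)] at h1
  have hCm : u ^ 2 / m ≤ C := by
    have := hC (u / m)
    have e : C - 2 * (u / m) * u + (u / m) ^ 2 * m = C - u ^ 2 / m := by field_simp; ring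
    linarith
  have hDm : v ^ 2 / m ≤ D := by
    have := hD (v / m)
    have e : D - 2 * (v / m) * v + (v / m) ^ 2 * m = D - v ^ 2 / m := by field_simp; ring
    linarith
  have hc2 : √(u / v) ^ 2 = u / v := Real.sq_sqrt (by positivity)
  have hc0 : 0 < √(u / v) := Real.sqrt_pos.2 (by positivity)
  set c := √(u / v) with hc
  have huc : u = c ^ 2 * v := by rw [hc2]; field_simp
  have hmc : m ≤ c * v := by
    apply le_of_sq_le_sq _ (by positivity)
    calc m ^ 2 ≤ u * v := hmuv
      _ = (c * v) ^ 2 := by rw [huc]; ring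
  refine ⟨c, hc0, by linarith, huc, hmc, ?_⟩
  calc v * (c ^ 4 + 1) / c = (u ^ 2 + v ^ 2) / (c * v) := by rw [huc]; field_simp
    _ ≤ (u ^ 2 + v ^ 2) / m := by gcongr
    _ = u ^ 2 / m + v ^ 2 / m := add_div _ _ _
    _ ≤ C + D := add_le_add hCm hDm

theorem integrable_of_memLp_three {Ω : Type*} [MeasurableSpace Ω] {μ : Measure Ω}
    [IsProbabilityMeasure μ] {X : Ω → ℝ} (hX : MemLp X 3 μ) :
    Integrable X μ ∧ Integrable (fun ω => X ω ^ 2) μ ∧ Integrable (fun ω => |X ω| ^ 3) μ :=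
  ⟨hX.integrable (by norm_num), (hX.mono_exponent (by norm_num)).integrable_sq,
    by simpa using hX.integrable_norm_pow (p := 3) (by norm_num)⟩

theorem integral_abs_sub_cube_le {Ω : Type*} [MeasurableSpace Ω] {μ : Measure Ω}
    [IsProbabilityMeasure μ] {X : Ω → ℝ} (hX : MemLp X 3 μ) (h1 : ∫ ω, X ω ∂μ = 0)
    (h2 : ∫ ω, X ω ^ 2 ∂μ = 1) {h : ℝ} (hh : 0 ≤ h) (hh1 : h ≤ 1) :
    ∫ ω, |X ω - h| ^ 3 ∂μ ≤ 1 + 3 * h ^ 2 + B (∫ ω, |X ω| ^ 3 ∂μ) := by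
  have hN : MemLp (fun ω => max (-X ω) 0) 3 μ := hX.neg.pos_part
  have hP : MemLp (fun ω => max (X ω) 0) 3 μ := hX.pos_part
  obtain ⟨i1, i2, i3⟩ := integrable_of_memLp_three hX
  obtain ⟨p1, p2, p3⟩ := integrable_of_memLp_three hP
  obtain ⟨n1, n2, n3⟩ := integrable_of_memLp_three hN
  have ap : ∀ ω, |max (X ω) 0| = max (X ω) 0 := fun ω => abs_of_nonneg (le_max_right _ _)
  have an : ∀ ω, |max (-X ω) 0| = max (-X ω) 0 := fun ω => abs_of_nonneg (le_max_right _ _)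
  simp only [ap] at p3
  simp only [an] at n3
  set m := ∫ ω, max (X ω) 0 ∂μ with hm
  set u := ∫ ω, max (X ω) 0 ^ 2 ∂μ with hu
  set v := ∫ ω, max (-X ω) 0 ^ 2 ∂μ with hv
  set C := ∫ ω, max (X ω) 0 ^ 3 ∂μ with hC
  set D := ∫ ω, max (-X ω) 0 ^ 3 ∂μ with hD
  have hm' : ∫ ω, max (-X ω) 0 ∂μ = m := by
    have : ∫ ω, X ω ∂μ = m - ∫ ω, max (-X ω) 0 ∂μ := by
      rw [hm, ← integral_sub p1 n1]
      congr 1 with ω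
      rcases le_total (X ω) 0 with hx | hx
      · rw [max_eq_right hx, max_eq_left (by linarith)]; ring
      · rw [max_eq_left hx, max_eq_right (by linarith)]; ring
    linarith
  have huv : u + v = 1 := by
    rw [hu, hv, ← integral_add p2 n2, ← h2]
    congr 1 with ω
    rcases le_total (X ω) 0 with hx | hx
    · rw [max_eq_right hx, max_eq_left (by linarith)]; ring
    · rw [max_eq_left hx, max_eq_right (by linarith)]; ring
  have hρ : ∫ ω, |X ω| ^ 3 ∂μ = C + D := by
    rw [hC, hD, ← integral_add p3 n3]
    congr 1 with ω
    rcases le_total (X ω) 0 with hx | hx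
    · rw [max_eq_right hx, max_eq_left (by linarith), abs_of_nonpos hx]; ring
    · rw [max_eq_left hx, max_eq_right (by linarith), abs_of_nonneg hx]; ring
  obtain ⟨c, hc, hcv, huc, hmc, hρc⟩ := exists_twoPoint_parameter (m := m) (u := u) (v := v)
    (C := C) (D := D) (integral_nonneg fun ω => le_max_right _ _)
    (integral_nonneg fun ω => sq_nonneg _) (integral_nonneg fun ω => sq_nonneg _) huv
    (fun t => by
      have e : C - 2 * t * u + t ^ 2 * m
          = ∫ ω, (max (X ω) 0 ^ 3 - 2 * t * max (X ω) 0 ^ 2 + t ^ 2 * max (X ω) 0) ∂μ := by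
        rw [integral_add (p3.sub' (p2.const_mul _)) (p1.const_mul _),
          integral_sub p3 (p2.const_mul _), integral_const_mul, integral_const_mul]
      rw [e]
      refine integral_nonneg fun ω => ?_
      have := mul_nonneg (le_max_right (X ω) 0) (sq_nonneg (max (X ω) 0 - t))
      simp only [Pi.zero_apply]
      linarith)
    (fun t => by
      have e : D - 2 * t * v + t ^ 2 * m
          = ∫ ω, (max (-X ω) 0 ^ 3 - 2 * t * max (-X ω) 0 ^ 2 + t ^ 2 * max (-X ω) 0) ∂μ := by
        rw [integral_add (n3.sub' (n2.const_mul _)) (n1.const_mul _),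
          integral_sub n3 (n2.const_mul _), integral_const_mul, integral_const_mul, hm']
      rw [e]
      refine integral_nonneg fun ω => ?_
      have := mul_nonneg (le_max_right (-X ω) 0) (sq_nonneg (max (-X ω) 0 - t))
      simp only [Pi.zero_apply]
      linarith)
    (fun α β => by
      have e : 2 * α * m - α ^ 2 * u + 2 * β * m - β ^ 2 * v
          = ∫ ω, (2 * α * max (X ω) 0 - α ^ 2 * max (X ω) 0 ^ 2
            + (2 * β * max (-X ω) 0 - β ^ 2 * max (-X ω) 0 ^ 2)) ∂μ := by
        rw [integral_add ((p1.const_mul _).sub' (p2.const_mul _))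
            ((n1.const_mul _).sub' (n2.const_mul _)),
          integral_sub (p1.const_mul _) (p2.const_mul _),
          integral_sub (n1.const_mul _) (n2.const_mul _)]
        simp only [integral_const_mul, hm']
        ring
      have e1 : (1 : ℝ) = ∫ _, (1 : ℝ) ∂μ := by simp
      rw [e, e1]
      refine integral_mono (((p1.const_mul _).sub' (p2.const_mul _)).fun_add
        ((n1.const_mul _).sub' (n2.const_mul _))) (integrable_const _) fun ω => ?_
      simp only
      rcases le_total (X ω) 0 with hx | hx
      · rw [max_eq_right hx, max_eq_left (by linarith)]
        nlinarith [sq_nonneg (1 + β * X ω)]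
      · rw [max_eq_left hx, max_eq_right (by linarith)]
        nlinarith [sq_nonneg (1 - α * X ω)])
  rw [hρ]
  -- Integrating a tangent inequality leaves αu - βm. As u = c²v, m ≤ cv and β ≥ 0, this is at least
  -- v times the tangent's value at c.
  have bound : ∀ α β : ℝ, 0 ≤ β → (∀ x : ℝ, |x - h| ^ 3 ≤ |x| ^ 3 + 3 * h * x ^ 2 - 3 * h ^ 2 * x
      + h ^ 3 - (α * max x 0 ^ 2 - β * max x 0)) →
      ∫ ω, |X ω - h| ^ 3 ∂μ ≤ (C + D) + 3 * h + h ^ 3 - v * (α * c ^ 2 - β * c) := by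
    intro α β hβ hle
    have hsub : MemLp (fun ω => X ω - h) 3 μ := hX.sub (memLp_const h)
    have hint := (((i3.add (i2.const_mul (3 * h))).sub (i1.const_mul (3 * h ^ 2))).add
      (integrable_const (h ^ 3))).sub ((p2.const_mul α).sub (p1.const_mul β))
    have := integral_mono (integrable_of_memLp_three hsub).2.2 hint fun ω => hle (X ω)
    refine this.trans (le_of_eq_of_le
      (b := (C + D) + 3 * h * 1 - 3 * h ^ 2 * 0 + h ^ 3 - (α * u - β * m)) ?_ ?_)
    · have j1 := i3.add (i2.const_mul (3 * h))
      have j2 := j1.sub (i1.const_mul (3 * h ^ 2))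
      have j3 := j2.add (integrable_const (h ^ 3))
      rw [integral_sub' j3 ((p2.const_mul α).sub (p1.const_mul β)),
        integral_add' j2 (integrable_const (h ^ 3)), integral_sub' j1 (i1.const_mul (3 * h ^ 2)),
        integral_add' i3 (i2.const_mul (3 * h)), integral_sub' (p2.const_mul α) (p1.const_mul β)]
      simp only [integral_const_mul, h1, h2, hρ]
      simp
      rfl
    · rw [huc]
      nlinarith [mul_le_mul_of_nonneg_left hmc hβ]
  rcases le_total c h with hch | hch
  · refine (bound _ _ (by positivity) (abs_sub_cube_le_of_le hc hch)).trans
      (le_of_eq_of_le ?_ (shift_gap_le hc hh hh1 hcv hρc (if_pos hch).symm))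
    ring
  · have hw : 6 * h * c ^ 2 - 6 * h ^ 2 * c + 2 * h ^ 3 =
        if c ≤ h then 2 * c ^ 3 else 6 * h * c ^ 2 - 6 * h ^ 2 * c + 2 * h ^ 3 := by
      split_ifs with hle
      · rw [le_antisymm hch hle]; ring
      · rfl
    refine (bound _ _ ?_ (abs_sub_cube_le_of_ge hh hc hch)).trans
      (le_of_eq_of_le ?_ (shift_gap_le hc hh hh1 hcv hρc hw))
    · have : 4 * h ^ 3 / c ≤ 4 * h ^ 2 := by
        rw [div_le_iff₀ hc]
        nlinarith [mul_nonneg (sq_nonneg h) (sub_nonneg.2 hch)]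
      nlinarith [sq_nonneg h]
    · field_simp
      ring

/-! ### The class of test functions -/

theorem boundedF3_hasDerivAt {f : ℝ → ℝ} (hf : f ∈ boundedF3) :
    (∀ x, HasDerivAt f (deriv f x) x) ∧ (∀ x, HasDerivAt (deriv f) (iteratedDeriv 2 f x) x) := by
  have hf2 : ContDiff ℝ 2 f := hf.1
  refine ⟨fun x => (hf2.differentiable (by norm_num) x).hasDerivAt, fun x => ?_⟩
  have h1 : ContDiff ℝ 1 (deriv f) := ((contDiff_succ_iff_deriv (n := 1)).1 hf2).2.2
  rw [iteratedDeriv_succ, iteratedDeriv_one]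
  exact (h1.differentiable (by norm_num) x).hasDerivAt

theorem mem_boundedF3 {f f' f'' : ℝ → ℝ} (hf : ∀ x, HasDerivAt f (f' x) x)
    (hf' : ∀ x, HasDerivAt f' (f'' x) x) (hL : LipschitzWith 1 f'') {M : ℝ}
    (hM : ∀ x, |f x| ≤ M) : f ∈ boundedF3 := by
  have e1 : deriv f = f' := funext fun x => (hf x).deriv
  have e2 : deriv f' = f'' := funext fun x => (hf' x).deriv
  refine ⟨?_, ?_, M, hM⟩
  · refine (contDiff_succ_iff_deriv (n := 1)).2 ⟨fun x => (hf x).differentiableAt, by simp, ?_⟩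
    rw [e1, contDiff_one_iff_deriv, e2]
    exact ⟨fun x => (hf' x).differentiableAt, hL.continuous⟩
  · rwa [iteratedDeriv_succ, iteratedDeriv_one, e1, e2]

theorem boundedF3_continuous {f : ℝ → ℝ} (hf : f ∈ boundedF3) : Continuous f :=
  ContDiff.continuous (hf.1 : ContDiff ℝ 2 f)

theorem boundedF3_integrable {f : ℝ → ℝ} (hf : f ∈ boundedF3) (P : Measure ℝ)
    [IsFiniteMeasure P] : Integrable f P := by
  obtain ⟨M, hM⟩ := hf.2.2
  exact .of_bound (boundedF3_continuous hf).aestronglyMeasurable M (.of_forall hM)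

theorem neg_mem_boundedF3 {f : ℝ → ℝ} (hf : f ∈ boundedF3) : (fun x => -f x) ∈ boundedF3 := by
  obtain ⟨h1, h2⟩ := boundedF3_hasDerivAt hf
  obtain ⟨M, hM⟩ := hf.2.2
  exact mem_boundedF3 (fun x => (h1 x).fun_neg) (fun x => (h2 x).fun_neg) hf.2.1.neg
    (M := M) (by simpa using hM)

theorem comp_add_mem_boundedF3 {f : ℝ → ℝ} (hf : f ∈ boundedF3) (a : ℝ) :
    (fun x => f (x + a)) ∈ boundedF3 := by
  obtain ⟨h1, h2⟩ := boundedF3_hasDerivAt hf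
  obtain ⟨M, hM⟩ := hf.2.2
  refine mem_boundedF3 (fun x => (h1 _).comp_add_const x a) (fun x => (h2 _).comp_add_const x a)
    (.of_dist_le_mul fun x y => ?_) (M := M) (fun x => hM _)
  simpa using hf.2.1.dist_le_mul (x + a) (y + a)

/-- Scaling the argument by c multiplies the Lipschitz constant of the second derivative by c³; this
is the source of the third-order homogeneity. -/
theorem comp_mul_mem_boundedF3 {f : ℝ → ℝ} (hf : f ∈ boundedF3) {c : ℝ} (hc : 0 < c) :
    (fun x => f (c * x) / c ^ 3) ∈ boundedF3 := by
  obtain ⟨h1, h2⟩ := boundedF3_hasDerivAt hf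
  obtain ⟨M, hM⟩ := hf.2.2
  refine mem_boundedF3 (f' := fun x => deriv f (c * x) / c ^ 2)
    (f'' := fun x => iteratedDeriv 2 f (c * x) / c) (M := M / c ^ 3) (fun x => ?_) (fun x => ?_)
    ?_ (fun x => ?_)
  · have := ((h1 (c * x)).comp x ((hasDerivAt_id x).const_mul c)).div_const (c ^ 3)
    exact this.congr_deriv (by field_simp)
  · have := ((h2 (c * x)).comp x ((hasDerivAt_id x).const_mul c)).div_const (c ^ 2)
    exact this.congr_deriv (by field_simp)
  · refine LipschitzWith.of_dist_le_mul fun x y => ?_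
    have := hf.2.1.dist_le_mul (c * x) (c * y)
    simp only [Real.dist_eq, NNReal.coe_one, one_mul] at this ⊢
    rw [← sub_div, abs_div, abs_of_pos hc, div_le_iff₀ hc]
    rw [← mul_sub, abs_mul, abs_of_pos hc] at this
    linarith
  · rw [abs_div, abs_of_pos (by positivity : 0 < c ^ 3)]
    gcongr
    exact hM _

/-! ### General properties of the Zolotarev distance -/

/-- A one-sided bound suffices because the test class is stable under negation; pointwise majorants
can therefore be used. -/
theorem zeta3_le_ofReal {P Q : Measure ℝ} {C : ℝ}
    (h : ∀ f ∈ boundedF3, ∫ x, f x ∂P - ∫ x, f x ∂Q ≤ C) : zeta3 P Q ≤ ENNReal.ofReal C := by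
  refine iSup₂_le fun f hf => ENNReal.ofReal_le_ofReal (abs_le.2 ⟨?_, h f hf⟩)
  have := h _ (neg_mem_boundedF3 hf)
  rw [integral_neg, integral_neg] at this
  linarith

theorem le_zeta3 (P Q : Measure ℝ) {f : ℝ → ℝ} (hf : f ∈ boundedF3) :
    ENNReal.ofReal |∫ x, f x ∂P - ∫ x, f x ∂Q| ≤ zeta3 P Q :=
  le_iSup₂ (f := fun f (_ : f ∈ boundedF3) => ENNReal.ofReal |∫ x, f x ∂P - ∫ x, f x ∂Q|) f hf

theorem zeta3_self (P : Measure ℝ) : zeta3 P P = 0 := by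
  simp [zeta3]

theorem zeta3_comm (P Q : Measure ℝ) : zeta3 P Q = zeta3 Q P := by
  simp only [zeta3, abs_sub_comm]

theorem zeta3_triangle (P Q R : Measure ℝ) : zeta3 P R ≤ zeta3 P Q + zeta3 Q R := by
  refine iSup₂_le fun f hf => ?_
  refine le_trans ?_ (add_le_add (le_zeta3 P Q hf) (le_zeta3 Q R hf))
  rw [← ENNReal.ofReal_add (abs_nonneg _) (abs_nonneg _)]
  exact ENNReal.ofReal_le_ofReal (abs_sub_le _ _ _)

theorem integral_conv_of_mem_boundedF3 {f : ℝ → ℝ} (hf : f ∈ boundedF3) (P Q : Measure ℝ)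
    [IsProbabilityMeasure P] [IsProbabilityMeasure Q] :
    ∫ x, f x ∂(P.conv Q) = ∫ y, ∫ x, f (x + y) ∂P ∂Q := by
  rw [Measure.conv_comm, integral_conv (boundedF3_integrable hf _)]
  simp only [add_comm]

theorem integrable_integral_comp_add {f : ℝ → ℝ} (hf : f ∈ boundedF3) (P Q : Measure ℝ)
    [IsProbabilityMeasure P] [IsProbabilityMeasure Q] :
    Integrable (fun y => ∫ x, f (x + y) ∂P) Q := by
  obtain ⟨M, hM⟩ := hf.2.2
  have hm : StronglyMeasurable (fun p : ℝ × ℝ => f (p.2 + p.1)) :=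
    ((boundedF3_continuous hf).comp (by fun_prop)).stronglyMeasurable
  refine .of_bound hm.integral_prod_right.aestronglyMeasurable M (.of_forall fun y => ?_)
  refine (norm_integral_le_of_norm_le_const (.of_forall fun x => hM (x + y))).trans ?_
  simp

/-- Convolution averages over translates of the test function, and the test class is translation
invariant. -/
theorem zeta3_conv_right_le (P Q S : Measure ℝ) [IsProbabilityMeasure P] [IsProbabilityMeasure Q]
    [IsProbabilityMeasure S] : zeta3 (P.conv S) (Q.conv S) ≤ zeta3 P Q := by
  by_cases htop : zeta3 P Q = ⊤
  · simp [htop]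
  rw [← ENNReal.ofReal_toReal htop]
  refine zeta3_le_ofReal fun f hf => ?_
  rw [integral_conv_of_mem_boundedF3 hf, integral_conv_of_mem_boundedF3 hf,
    ← integral_sub (integrable_integral_comp_add hf P S) (integrable_integral_comp_add hf Q S)]
  have : ∫ _, (zeta3 P Q).toReal ∂S = (zeta3 P Q).toReal := by simp
  rw [← this]
  refine integral_mono ((integrable_integral_comp_add hf P S).sub
    (integrable_integral_comp_add hf Q S)) (integrable_const _) fun y => ?_
  refine (le_abs_self _).trans ?_
  rw [← ENNReal.ofReal_le_iff_le_toReal htop]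
  exact le_zeta3 P Q (comp_add_mem_boundedF3 hf y)

theorem zeta3_conv_left_le (P Q S : Measure ℝ) [IsProbabilityMeasure P] [IsProbabilityMeasure Q]
    [IsProbabilityMeasure S] : zeta3 (S.conv P) (S.conv Q) ≤ zeta3 P Q := by
  rw [Measure.conv_comm S P, Measure.conv_comm S Q]
  exact zeta3_conv_right_le P Q S

theorem zeta3_map_mul_le (P Q : Measure ℝ) {c : ℝ} (hc : 0 < c) :
    zeta3 (P.map (c * ·)) (Q.map (c * ·)) ≤ ENNReal.ofReal (c ^ 3) * zeta3 P Q := by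
  refine iSup₂_le fun f hf => ?_
  refine le_trans (le_of_eq ?_) (mul_le_mul_right (le_zeta3 P Q (comp_mul_mem_boundedF3 hf hc)) _)
  have hm : ∀ μ : Measure ℝ, AEStronglyMeasurable f μ :=
    fun μ => (boundedF3_continuous hf).aestronglyMeasurable
  rw [integral_map (by fun_prop) (hm _), integral_map (by fun_prop) (hm _),
    ← ENNReal.ofReal_mul (by positivity), integral_div, integral_div, ← sub_div, abs_div,
    abs_of_pos (by positivity : 0 < c ^ 3), mul_div_cancel₀ _ (by positivity)]

theorem isProbabilityMeasure_iterConv {P : ℕ → Measure ℝ} {n : ℕ}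
    (hP : ∀ i ∈ Finset.Icc 1 n, IsProbabilityMeasure (P i)) :
    IsProbabilityMeasure (iterConv P n) := by
  induction n with
  | zero => exact inferInstanceAs (IsProbabilityMeasure (Measure.dirac 0))
  | succ n ih =>
    have := ih fun i hi => hP i (Finset.Icc_subset_Icc_right n.le_succ hi)
    have := hP (n + 1) (by simp)
    exact inferInstanceAs (IsProbabilityMeasure ((iterConv P n).conv (P (n + 1))))

/-- Lindeberg's telescoping of the distance between two convolution products. -/
theorem zeta3_iterConv_le_sum {P Q : ℕ → Measure ℝ} {n : ℕ}
    (hP : ∀ i ∈ Finset.Icc 1 n, IsProbabilityMeasure (P i))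
    (hQ : ∀ i ∈ Finset.Icc 1 n, IsProbabilityMeasure (Q i)) :
    zeta3 (iterConv P n) (iterConv Q n) ≤ ∑ k ∈ Finset.range n,
      zeta3 ((iterConv Q k).conv (P (k + 1))) ((iterConv Q k).conv (Q (k + 1))) := by
  induction n with
  | zero => simp [iterConv, zeta3_self]
  | succ n ih =>
    have hP' := fun i hi => hP i (Finset.Icc_subset_Icc_right n.le_succ hi)
    have hQ' := fun i hi => hQ i (Finset.Icc_subset_Icc_right n.le_succ hi)
    have := isProbabilityMeasure_iterConv hP'
    have := isProbabilityMeasure_iterConv hQ'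
    have := hP (n + 1) (by simp)
    have := hQ (n + 1) (by simp)
    rw [Finset.sum_range_succ]
    refine (zeta3_triangle _ ((iterConv Q n).conv (P (n + 1))) _).trans ?_
    exact add_le_add ((zeta3_conv_right_le _ _ _).trans (ih hP' hQ')) le_rfl

theorem zeta3_iterConv_le_sum_zeta3 {P Q : ℕ → Measure ℝ} {n : ℕ}
    (hP : ∀ i ∈ Finset.Icc 1 n, IsProbabilityMeasure (P i))
    (hQ : ∀ i ∈ Finset.Icc 1 n, IsProbabilityMeasure (Q i)) :
    zeta3 (iterConv P n) (iterConv Q n) ≤ ∑ i ∈ Finset.Icc 1 n, zeta3 (P i) (Q i) := by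
  refine (zeta3_iterConv_le_sum hP hQ).trans ?_
  rw [← Finset.Ico_add_one_right_eq_Icc, Finset.sum_Ico_eq_sum_range]
  simp only [Nat.add_sub_cancel]
  refine Finset.sum_le_sum fun k hk => ?_
  have hk := Finset.mem_range.1 hk
  have := isProbabilityMeasure_iterConv (P := Q) (n := k)
    fun i hi => hQ i (Finset.Icc_subset_Icc_right hk.le hi)
  have := hP (k + 1) (by simp; omega)
  have := hQ (k + 1) (by simp; omega)
  rw [add_comm 1 k]
  exact zeta3_conv_left_le _ _ _

/-! ### Standardized convolutions -/

theorem conv_map_affine (P Q : Measure ℝ) [IsProbabilityMeasure P] [IsProbabilityMeasure Q]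
    (a b s : ℝ) : (P.conv Q).map (fun x => (x - (a + b)) / s)
      = (P.map (fun x => (x - a) / s)).conv (Q.map (fun x => (x - b) / s)) := by
  have : IsProbabilityMeasure (P.map (fun x => (x - a) / s)) :=
    Measure.isProbabilityMeasure_map (by fun_prop)
  have : IsProbabilityMeasure (Q.map (fun x => (x - b) / s)) :=
    Measure.isProbabilityMeasure_map (by fun_prop)
  rw [Measure.conv, Measure.conv, Measure.map_map (by fun_prop) (by fun_prop),
    Measure.map_prod_map _ _ (by fun_prop) (by fun_prop),
    Measure.map_map (by fun_prop) (by fun_prop)]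
  congr 1
  ext x
  simp only [Function.comp, Prod.map]
  ring

theorem iterConv_map_affine {P : ℕ → Measure ℝ} {n : ℕ}
    (hP : ∀ i ∈ Finset.Icc 1 n, IsProbabilityMeasure (P i)) (a : ℕ → ℝ) (s : ℝ) :
    (iterConv P n).map (fun x => (x - ∑ i ∈ Finset.Icc 1 n, a i) / s)
      = iterConv (fun i => (P i).map (fun x => (x - a i) / s)) n := by
  induction n with
  | zero => simp [iterConv, Measure.map_dirac' (show Measurable fun x : ℝ => x / s by fun_prop)]
  | succ n ih =>
    have hP' := fun i hi => hP i (Finset.Icc_subset_Icc_right n.le_succ hi)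
    have := isProbabilityMeasure_iterConv hP'
    have := hP (n + 1) (by simp)
    rw [Finset.sum_Icc_succ_top (by omega), iterConv, iterConv, conv_map_affine, ih hP']

theorem memLp_conv {P Q : Measure ℝ} [IsProbabilityMeasure P] [IsProbabilityMeasure Q]
    (hP : MemLp (fun x => x) 2 P) (hQ : MemLp (fun x => x) 2 Q) :
    MemLp (fun x => x) 2 (P.conv Q) ∧ mean (P.conv Q) = mean P + mean Q ∧
      variance (fun x => x) (P.conv Q) = variance (fun x => x) P + variance (fun x => x) Q := by
  have h1 : MemLp (fun p : ℝ × ℝ => p.1) 2 (P.prod Q) :=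
    hP.comp_measurePreserving measurePreserving_fst
  have h2 : MemLp (fun p : ℝ × ℝ => p.2) 2 (P.prod Q) :=
    hQ.comp_measurePreserving measurePreserving_snd
  have hmap : MemLp (fun x => x) 2 (P.conv Q) :=
    (memLp_map_measure_iff (by fun_prop) (by fun_prop)).2 (h1.add h2)
  have m1 : ∫ p : ℝ × ℝ, p.1 ∂(P.prod Q) = mean P := by
    rw [integral_fun_fst (fun x => x)]; simp [mean]
  have m2 : ∫ p : ℝ × ℝ, p.2 ∂(P.prod Q) = mean Q := by
    rw [integral_fun_snd (fun x => x)]; simp [mean]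
  refine ⟨hmap, ?_, ?_⟩
  · rw [mean, Measure.conv, integral_map (by fun_prop) (by fun_prop),
      integral_add (h1.integrable (by norm_num)) (h2.integrable (by norm_num)), m1, m2]
  · rw [Measure.conv, variance_map (by fun_prop) (by fun_prop)]
    have := (indepFun_prod (μ := P) (ν := Q) measurable_id measurable_id).variance_add h1 h2
    refine this.trans (congr_arg₂ _ ?_ ?_)
    · rw [← Measure.fst_prod (μ := P) (ν := Q), Measure.fst, variance_map (by fun_prop) (by fun_prop)]
      simp [Function.comp_def]
    · rw [← Measure.snd_prod (μ := P) (ν := Q), Measure.snd, variance_map (by fun_prop) (by fun_prop)]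
      simp [Function.comp_def]

theorem memLp_iterConv {P : ℕ → Measure ℝ} {n : ℕ}
    (hP : ∀ i ∈ Finset.Icc 1 n, IsProbabilityMeasure (P i))
    (hL : ∀ i ∈ Finset.Icc 1 n, MemLp (fun x => x) 2 (P i)) :
    MemLp (fun x => x) 2 (iterConv P n) ∧ mean (iterConv P n) = ∑ i ∈ Finset.Icc 1 n, mean (P i) ∧
      variance (fun x => x) (iterConv P n) = ∑ i ∈ Finset.Icc 1 n, variance (fun x => x) (P i) := by
  induction n with
  | zero =>
    refine ⟨?_, by simp [iterConv, mean], by simp [iterConv]⟩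
    have : IsFiniteMeasure (iterConv P 0) := inferInstanceAs (IsFiniteMeasure (Measure.dirac 0))
    exact memLp_of_bounded (a := 0) (b := 0) (by simp [iterConv]) (by fun_prop) _
  | succ n ih =>
    have hP' := fun i hi => hP i (Finset.Icc_subset_Icc_right n.le_succ hi)
    have hL' := fun i hi => hL i (Finset.Icc_subset_Icc_right n.le_succ hi)
    have := isProbabilityMeasure_iterConv hP'
    have := hP (n + 1) (by simp)
    obtain ⟨i1, i2, i3⟩ := ih hP' hL'
    rw [Finset.sum_Icc_succ_top (by omega), Finset.sum_Icc_succ_top (by omega), iterConv, ← i2, ← i3]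
    exact memLp_conv i1 (hL _ (by simp))

theorem standardize_iterConv {P : ℕ → Measure ℝ} {n : ℕ}
    (hP : ∀ i ∈ Finset.Icc 1 n, IsProbabilityMeasure (P i))
    (hL : ∀ i ∈ Finset.Icc 1 n, MemLp (fun x => x) 2 (P i)) :
    standardize (iterConv P n) = iterConv (fun i => (P i).map
      (fun x => (x - mean (P i)) / √(∑ i ∈ Finset.Icc 1 n, stdDev (P i) ^ 2))) n := by
  obtain ⟨-, h2, h3⟩ := memLp_iterConv hP hL
  rw [standardize, stdDev, h2, h3, iterConv_map_affine hP]
  simp only [stdDev, Real.sq_sqrt (variance_nonneg _ _)]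

/-! ### Symmetric two-point laws -/

instance isProbabilityMeasure_symTwoPoint (s : ℝ) : IsProbabilityMeasure (symTwoPoint s) :=
  ⟨by simp [symTwoPoint, ENNReal.inv_two_add_inv_two]⟩

theorem integral_symTwoPoint (f : ℝ → ℝ) (s : ℝ) :
    ∫ x, f x ∂(symTwoPoint s) = (f s + f (-s)) / 2 := by
  rw [symTwoPoint, integral_smul_measure, integral_add_measure (integrable_dirac (by simp))
    (integrable_dirac (by simp)), integral_dirac, integral_dirac]
  simp
  ring

theorem map_symTwoPoint {f : ℝ → ℝ} (hf : Measurable f) {s t : ℝ} (h1 : f s = t)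
    (h2 : f (-s) = -t) : (symTwoPoint s).map f = symTwoPoint t := by
  rw [symTwoPoint, Measure.map_smul, Measure.map_add _ _ hf, Measure.map_dirac' hf,
    Measure.map_dirac' hf, h1, h2, symTwoPoint]

theorem memLp_symTwoPoint (s : ℝ) (p : ENNReal) : MemLp (fun x => x) p (symTwoPoint s) := by
  refine MemLp.of_bound (by fun_prop) |s| ?_
  rw [symTwoPoint]
  refine Measure.ae_smul_measure ?_ _
  rw [ae_add_measure_iff]
  simp

theorem mean_symTwoPoint (s : ℝ) : mean (symTwoPoint s) = 0 := by
  rw [mean, integral_symTwoPoint (fun x => x)]; ring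

theorem stdDev_symTwoPoint {s : ℝ} (hs : 0 ≤ s) : stdDev (symTwoPoint s) = s := by
  have h0 := mean_symTwoPoint s
  rw [mean] at h0
  rw [stdDev, variance_eq_integral (by fun_prop), h0, integral_symTwoPoint (fun x => (x - 0) ^ 2)]
  rw [show ((s - 0) ^ 2 + (-s - 0) ^ 2) / 2 = s ^ 2 by ring, Real.sqrt_sq hs]

/-- The sharp bound for the distance between a standardized law and the symmetric two-point law. -/
theorem zeta3_symTwoPoint_le {P : Measure ℝ} [IsProbabilityMeasure P]
    (hP : MemLp (fun x => x) 3 P) (h1 : ∫ x, x ∂P = 0) (h2 : ∫ x, x ^ 2 ∂P = 1) :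
    zeta3 P (symTwoPoint 1) ≤ ENNReal.ofReal (B (∫ x, |x| ^ 3 ∂P) / 6) := by
  refine zeta3_le_ofReal fun f hf => ?_
  obtain ⟨hd, hd'⟩ := boundedF3_hasDerivAt hf
  obtain ⟨h, hh, α, β, κ, hle, heq⟩ := exists_centered_cubic_majorant hd hd' hf.2.1
  obtain ⟨i1, i2, i3⟩ := integrable_of_memLp_three hP
  have j3 := (integrable_of_memLp_three (hP.sub (memLp_const h))).2.2
  have key : ∫ x, |x - h| ^ 3 ∂P ≤ 1 + 3 * h ^ 2 + B (∫ x, |x| ^ 3 ∂P) := by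
    rcases le_total 0 h with h0 | h0
    · exact integral_abs_sub_cube_le hP h1 h2 h0 hh.2
    -- A negative shift is handled by reflecting the law, which preserves |X|³.
    · have := integral_abs_sub_cube_le hP.neg ((integral_neg _).trans (by rw [h1, neg_zero]))
        (by simpa using h2) (neg_nonneg.2 h0) (by linarith [hh.1])
      have e : ∀ x : ℝ, |x - h| = |(-fun x : ℝ => x) x - -h| := fun x => by
        rw [abs_sub_comm]; congr 1; simp; ring
      simp only [e]
      refine this.trans (le_of_eq ?_)
      simp
  have hq : ∫ x, (κ + β * x + α * x ^ 2) ∂P = κ + α := by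
    rw [integral_add (((integrable_const κ).fun_add (i1.const_mul β))) (i2.const_mul α),
      integral_add (integrable_const κ) (i1.const_mul β), integral_const_mul, integral_const_mul,
      h1, h2]
    simp
  have hqi : Integrable (fun x => κ + β * x + α * x ^ 2) P :=
    ((integrable_const κ).fun_add (i1.const_mul β)).fun_add (i2.const_mul α)
  have hb := integral_mono (boundedF3_integrable hf P) ((j3.div_const 6).fun_add hqi) hle
  rw [integral_add (j3.div_const 6) hqi, hq, integral_div] at hb
  rw [integral_symTwoPoint f, heq]
  simp only [Pi.sub_apply] at hb
  linarith

/-! ### Gaussian moments -/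

theorem integral_abs_pow_gaussian (k : ℕ) : ∫ x, |x| ^ k ∂(gaussianReal 0 1)
    = (√(2 * Real.pi))⁻¹ * ((1 / 2 : ℝ) ^ (-((k : ℝ) + 1) / 2) * Real.Gamma (((k : ℝ) + 1) / 2)) := by
  rw [integral_gaussianReal_eq_integral_smul one_ne_zero]
  have e : ∀ x : ℝ, gaussianPDFReal 0 1 x • |x| ^ k
      = (fun y : ℝ => (√(2 * Real.pi))⁻¹ * (y ^ (k : ℝ) * Real.exp (-(1 / 2) * y ^ (2 : ℝ)))) |x| := by
    intro x
    simp only [gaussianPDFReal, NNReal.coe_one, mul_one, sub_zero, smul_eq_mul, Real.rpow_natCast,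
      Real.rpow_ofNat, sq_abs]
    rw [show -x ^ 2 / 2 = -(1 / 2) * x ^ 2 by ring]
    ring
  rw [integral_congr_ae (.of_forall e)]
  refine (integral_comp_abs (f := fun y : ℝ =>
    (√(2 * Real.pi))⁻¹ * (y ^ (k : ℝ) * Real.exp (-(1 / 2) * y ^ (2 : ℝ))))).trans ?_
  rw [integral_const_mul,
    integral_rpow_mul_exp_neg_mul_rpow two_pos (by linarith [k.cast_nonneg (α := ℝ)])
      (by norm_num : (0 : ℝ) < 1 / 2)]
  ring

theorem two_div_sqrt_two_pi : 2 * (√(2 * Real.pi))⁻¹ = √(2 / Real.pi) := by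
  have hp := Real.pi_pos
  rw [eq_comm, Real.sqrt_eq_iff_mul_self_eq (by positivity) (by positivity)]
  have : √(2 * Real.pi) * √(2 * Real.pi) = 2 * Real.pi := Real.mul_self_sqrt (by positivity)
  field_simp
  nlinarith

theorem integral_abs_gaussian : ∫ x, |x| ∂(gaussianReal 0 1) = √(2 / Real.pi) := by
  have := integral_abs_pow_gaussian 1
  norm_num at this
  rw [this, ← two_div_sqrt_two_pi, Real.sqrt_mul two_pos.le, mul_inv]
  ring

theorem integral_abs_cube_gaussian : ∫ x, |x| ^ 3 ∂(gaussianReal 0 1) = 2 * √(2 / Real.pi) := by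
  have := integral_abs_pow_gaussian 3
  norm_num at this
  rw [this, ← two_div_sqrt_two_pi, Real.sqrt_mul two_pos.le, mul_inv]
  ring

theorem integral_pow_four_gaussian : ∫ x, x ^ 4 ∂(gaussianReal 0 1) = 3 := by
  have := integral_abs_pow_gaussian 4
  have e : ∀ x : ℝ, |x| ^ 4 = x ^ 4 := fun x => (by decide : Even 4).pow_abs x
  simp only [e] at this
  have hG : Real.Gamma (5 / 2) = 3 / 4 * √Real.pi := by
    rw [show (5 / 2 : ℝ) = 3 / 2 + 1 by norm_num, Real.Gamma_add_one (by norm_num),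
      show (3 / 2 : ℝ) = 1 / 2 + 1 by norm_num, Real.Gamma_add_one (by norm_num),
      Real.Gamma_one_half_eq]
    ring
  have hr : (1 / 2 : ℝ) ^ (-(5 : ℝ) / 2) = 4 * √2 := by
    rw [one_div, Real.inv_rpow (by norm_num), ← Real.rpow_neg (by norm_num),
      show -(-(5 : ℝ) / 2) = 2 + 1 / 2 by norm_num, Real.rpow_add (by norm_num), ← Real.sqrt_eq_rpow]
    norm_num
  rw [this]
  norm_num [hG]
  norm_num at hr
  rw [hr]
  have : 0 < √Real.pi := Real.sqrt_pos.2 Real.pi_pos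
  field_simp

theorem memLp_gaussian (p : ENNReal) (hp : p ≠ ⊤) : MemLp (fun x => x) p (gaussianReal 0 1) :=
  memLp_id_gaussianReal' p hp

theorem integral_sq_gaussian : ∫ x, x ^ 2 ∂(gaussianReal 0 1) = 1 := by
  have h := variance_fun_id_gaussianReal (μ := 0) (v := 1)
  rw [variance_eq_integral (by fun_prop), integral_id_gaussianReal] at h
  simpa using h

/-- Both laws are symmetric, so f may be replaced by its even part. Its defect at ±1 vanishes, hence
h = 0 works and the bound is (E|Z|³ - 1)/6. -/
theorem zeta3_symTwoPoint_gaussian_le : zeta3 (symTwoPoint 1) (gaussianReal 0 1)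
    ≤ ENNReal.ofReal (1 / 6 * (2 * √(2 / Real.pi) - 1)) := by
  rw [zeta3_comm]
  refine zeta3_le_ofReal fun f hf => ?_
  obtain ⟨hd, hd'⟩ := boundedF3_hasDerivAt hf
  have hgd : ∀ x, HasDerivAt (fun x => (f x + f (-x)) / 2) ((deriv f x - deriv f (-x)) / 2) x :=
    fun x => (((hd x).fun_add (hasDerivAt_comp_neg (hd (-x)))).div_const 2).congr_deriv (by ring)
  have hgd' : ∀ x, HasDerivAt (fun x => (deriv f x - deriv f (-x)) / 2)
      ((iteratedDeriv 2 f x + iteratedDeriv 2 f (-x)) / 2) x :=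
    fun x => (((hd' x).fun_sub (hasDerivAt_comp_neg (hd' (-x)))).div_const 2).congr_deriv (by ring)
  have hL : LipschitzWith 1 fun x => (iteratedDeriv 2 f x + iteratedDeriv 2 f (-x)) / 2 := by
    refine .of_dist_le_mul fun x y => ?_
    have h1 := hf.2.1.dist_le_mul x y
    have h2 := hf.2.1.dist_le_mul (-x) (-y)
    simp only [Real.dist_eq, NNReal.coe_one, one_mul] at *
    rw [neg_sub_neg, abs_sub_comm y x] at h2
    rw [abs_le] at *
    constructor <;> linarith [h1.1, h1.2, h2.1, h2.2]
  obtain ⟨α, β, κ, hle, heq⟩ := exists_cubic_majorant hgd hgd' hL (h := 0) (by norm_num)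
    (by norm_num; ring)
  simp only [sub_zero] at hle
  obtain ⟨i1, i2, i3⟩ := integrable_of_memLp_three (memLp_gaussian 3 (by norm_num))
  have hq : ∫ x, (κ + β * x + α * x ^ 2) ∂(gaussianReal 0 1) = κ + α := by
    rw [integral_add (((integrable_const κ).fun_add (i1.const_mul β))) (i2.const_mul α),
      integral_add (integrable_const κ) (i1.const_mul β), integral_const_mul, integral_const_mul,
      integral_id_gaussianReal, integral_sq_gaussian]
    simp
  have hqi : Integrable (fun x => κ + β * x + α * x ^ 2) (gaussianReal 0 1) :=
    ((integrable_const κ).fun_add (i1.const_mul β)).fun_add (i2.const_mul α)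
  have hf1 := boundedF3_integrable hf (gaussianReal 0 1)
  have hmap : (gaussianReal 0 1).map (fun x => -x) = gaussianReal 0 1 := by
    rw [gaussianReal_map_neg, neg_zero]
  have hf2 : Integrable (fun x => f (-x)) (gaussianReal 0 1) := by
    have := hf1
    rw [← hmap] at this
    exact this.comp_measurable (by fun_prop)
  have hsymm : ∫ x, f (-x) ∂(gaussianReal 0 1) = ∫ x, f x ∂(gaussianReal 0 1) := by
    conv_rhs => rw [← hmap]
    rw [integral_map (by fun_prop) (boundedF3_continuous hf).aestronglyMeasurable]
  have hb := integral_mono ((hf1.fun_add hf2).div_const 2) ((i3.div_const 6).fun_add hqi) hle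
  rw [integral_add (i3.div_const 6) hqi, hq, integral_div, integral_div, integral_add hf1 hf2, hsymm,
    integral_abs_cube_gaussian] at hb
  rw [integral_symTwoPoint f]
  norm_num at heq
  linarith

/-! ### Smoothing by a Gaussian law -/

/-- The mean value theorem finds points with |f'| ≤ 2M in every unit interval, then a point within 3
of x with |f''| ≤ 4M; the Lipschitz condition does the rest. These bounds supply the domination for
differentiating smoothed functions and for Stein's identity. -/
theorem exists_bound_derivs {f f' f'' : ℝ → ℝ} (hf : ∀ x, HasDerivAt f (f' x) x)
    (hf' : ∀ x, HasDerivAt f' (f'' x) x) (hL : LipschitzWith 1 f'') {M : ℝ}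
    (hM : ∀ x, |f x| ≤ M) : ∃ A, (∀ x, |f' x| ≤ A) ∧ ∀ x, |f'' x| ≤ A := by
  have hmv : ∀ x, ∃ ξ ∈ Set.Ioo x (x + 1), |f' ξ| ≤ 2 * M := fun x => by
    obtain ⟨ξ, hξ, h⟩ := exists_hasDerivAt_eq_slope f f' (lt_add_one x)
      (fun y _ => (hf y).continuousAt.continuousWithinAt) (fun y _ => hf y)
    refine ⟨ξ, hξ, ?_⟩
    rw [h, add_sub_cancel_left, div_one]
    exact (abs_sub _ _).trans (by linarith [hM (x + 1), hM x])
  have hM0 : 0 ≤ M := (abs_nonneg _).trans (hM 0)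
  have h2 : ∀ x, |f'' x| ≤ 4 * M + 3 := fun x => by
    obtain ⟨ξ, hξ, h⟩ := hmv x
    obtain ⟨ζ, hζ, h'⟩ := hmv (x + 2)
    have hlt : ξ < ζ := by linarith [hξ.2, hζ.1]
    obtain ⟨η, hη, he⟩ := exists_hasDerivAt_eq_slope f' f'' hlt
      (fun y _ => (hf' y).continuousAt.continuousWithinAt) (fun y _ => hf' y)
    have h4 : |f'' η| ≤ 4 * M := by
      rw [he, abs_div, div_le_iff₀ (abs_pos.2 (by linarith))]
      have : 1 ≤ |ζ - ξ| := (by linarith [hξ.2, hζ.1] : 1 ≤ ζ - ξ).trans (le_abs_self _)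
      have := (abs_sub (f' ζ) (f' ξ))
      nlinarith
    have h5 := hL.dist_le_mul x η
    simp only [Real.dist_eq, NNReal.coe_one, one_mul] at h5
    have h6 : |x - η| ≤ 3 := abs_le.2 ⟨by linarith [hη.2, hζ.2], by linarith [hη.1, hξ.1]⟩
    have := abs_add_le (f'' x - f'' η) (f'' η)
    rw [sub_add_cancel] at this
    linarith
  refine ⟨6 * M + 3, fun x => ?_, fun x => (h2 x).trans (by linarith)⟩
  obtain ⟨ξ, hξ, h⟩ := hmv x
  obtain ⟨η, hη, he⟩ := exists_hasDerivAt_eq_slope f' f'' hξ.1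
    (fun y _ => (hf' y).continuousAt.continuousWithinAt) (fun y _ => hf' y)
  have e : f' ξ - f' x = f'' η * (ξ - x) := by
    rw [he]; field_simp [(sub_pos.2 hξ.1).ne']
  have h3 : |f' ξ - f' x| ≤ 4 * M + 3 := by
    rw [e, abs_mul, abs_of_pos (sub_pos.2 hξ.1)]
    have h7 : ξ - x ≤ 1 := by linarith [hξ.2]
    nlinarith [h2 η, abs_nonneg (f'' η), hξ.1]
  have := abs_sub (f' ξ) (f' ξ - f' x)
  rw [sub_sub_cancel] at this
  linarith

theorem hasDerivAt_integral_comp_add_mul {μ : Measure ℝ} {g g' w : ℝ → ℝ}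
    (hg : ∀ x, HasDerivAt g (g' x) x) (hg' : Continuous g') {A A' : ℝ} (hA : ∀ x, |g x| ≤ A)
    (hA' : ∀ x, |g' x| ≤ A') (hw : Integrable w μ) (τ x : ℝ) :
    HasDerivAt (fun x => ∫ z, g (x + τ * z) * w z ∂μ) (∫ z, g' (x + τ * z) * w z ∂μ) x := by
  have hgc : Continuous g := continuous_iff_continuousAt.2 fun y => (hg y).continuousAt
  have hm : ∀ x, AEStronglyMeasurable (fun z => g (x + τ * z) * w z) μ := fun x =>
    (hgc.comp (by fun_prop)).aestronglyMeasurable.mul hw.1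
  refine (hasDerivAt_integral_of_dominated_loc_of_deriv_le (F' := fun x z => g' (x + τ * z) * w z)
    (bound := fun z => A' * |w z|) Filter.univ_mem (.of_forall hm) ?_ ?_ ?_ ?_ ?_).2
  · exact hw.bdd_mul (hgc.comp (by fun_prop)).aestronglyMeasurable (.of_forall fun z => hA _)
  · exact (hg'.comp (by fun_prop)).aestronglyMeasurable.mul hw.1
  · refine .of_forall fun z x _ => ?_
    rw [norm_mul]
    exact mul_le_mul_of_nonneg_right (hA' _) (abs_nonneg _)
  · exact hw.abs.const_mul A'
  · exact .of_forall fun z x _ => ((hg _).comp_add_const x (τ * z)).mul_const (w z)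

theorem hasDerivAt_gaussianPDFReal (x : ℝ) :
    HasDerivAt (gaussianPDFReal 0 1) (-(x * gaussianPDFReal 0 1 x)) x := by
  have h : HasDerivAt (fun y : ℝ => -y ^ 2 / 2) (-x) x :=
    (((hasDerivAt_pow 2 x).fun_neg).div_const 2).congr_deriv (by push_cast; ring)
  have e : gaussianPDFReal 0 1 = fun y => (√(2 * Real.pi))⁻¹ * Real.exp (-y ^ 2 / 2) := by
    ext y
    simp [gaussianPDFReal]
  rw [e]
  exact (h.exp.const_mul _).congr_deriv (by ring)

theorem integrable_gaussian_iff {g : ℝ → ℝ} :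
    Integrable g (gaussianReal 0 1) ↔ Integrable (fun x => gaussianPDFReal 0 1 x * g x) := by
  rw [gaussianReal_of_var_ne_zero 0 one_ne_zero, integrable_withDensity_iff_integrable_smul'
    (measurable_gaussianPDF 0 1) (.of_forall fun _ => gaussianPDF_lt_top)]
  simp only [toReal_gaussianPDF, smul_eq_mul]

/-- Stein's identity. -/
theorem integral_deriv_gaussian {u u' : ℝ → ℝ} (hu : ∀ x, HasDerivAt u (u' x) x)
    (hu' : Continuous u') {A A' : ℝ} (hA : ∀ x, |u x| ≤ A) (hA' : ∀ x, |u' x| ≤ A') :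
    ∫ z, u' z ∂(gaussianReal 0 1) = ∫ z, u z * z ∂(gaussianReal 0 1) := by
  have huc : Continuous u := continuous_iff_continuousAt.2 fun y => (hu y).continuousAt
  have iu : Integrable u (gaussianReal 0 1) :=
    .of_bound huc.aestronglyMeasurable A (.of_forall hA)
  have iu' : Integrable u' (gaussianReal 0 1) :=
    .of_bound hu'.aestronglyMeasurable A' (.of_forall hA')
  have iuz : Integrable (fun z => u z * z) (gaussianReal 0 1) :=
    ((memLp_id_gaussianReal 1).integrable (by norm_num)).bdd_mul huc.aestronglyMeasurable
      (.of_forall hA)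
  rw [integrable_gaussian_iff] at iu iu' iuz
  rw [integral_gaussianReal_eq_integral_smul one_ne_zero,
    integral_gaussianReal_eq_integral_smul one_ne_zero]
  have := integral_mul_deriv_eq_deriv_mul_of_integrable (u := u) (u' := u')
    (v := gaussianPDFReal 0 1) (v' := fun x => -(x * gaussianPDFReal 0 1 x)) (fun x _ => hu x)
    (fun x _ => hasDerivAt_gaussianPDFReal x)
    (iuz.neg.congr (.of_forall fun x => by simp only [Pi.neg_apply, Pi.mul_apply]; ring))
    (iu'.congr (.of_forall fun x => by simp only [Pi.mul_apply]; ring))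
    (iu.congr (.of_forall fun x => by simp only [Pi.mul_apply]; ring))
  simp only [smul_eq_mul]
  have e1 : ∫ x, gaussianPDFReal 0 1 x * u' x = ∫ x, u' x * gaussianPDFReal 0 1 x := by
    simp only [mul_comm]
  have e2 : ∫ x, gaussianPDFReal 0 1 x * (u x * x)
      = -∫ x, u x * -(x * gaussianPDFReal 0 1 x) := by
    rw [← integral_neg]
    congr 1 with x
    ring
  rw [e1, e2, this, neg_neg]

/-- The tangent inequality in the variable `x ^ 2`. -/
theorem sq_tangent_le {G G₁ G₂ G₃ : ℝ → ℝ} (h1 : ∀ x, HasDerivAt G (G₁ x) x)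
    (h2 : ∀ x, HasDerivAt G₁ (G₂ x) x) (h3 : ∀ x, HasDerivAt G₂ (G₃ x) x)
    (hpos : ∀ x, 0 ≤ x → 0 ≤ G₃ x) (h0 : G₁ 0 = 0) {c : ℝ} (hc : 0 < c) {x : ℝ} (hx : 0 ≤ x) :
    G c + G₁ c / (2 * c) * (x ^ 2 - c ^ 2) ≤ G x := by
  have hd : deriv G₁ = G₂ := funext fun y => (h2 y).deriv
  have hmono : MonotoneOn G₂ (Set.Ici 0) := by
    apply monotoneOn_of_deriv_nonneg (convex_Ici _)
    · exact fun y _ => (h3 y).continuousAt.continuousWithinAt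
    · exact fun y _ => (h3 y).differentiableAt.differentiableWithinAt
    · intro y hy
      rw [(h3 y).deriv]
      exact hpos y (interior_subset hy)
  have hconv : ConvexOn ℝ (Set.Ici 0) G₁ := by
    apply MonotoneOn.convexOn_of_deriv (convex_Ici _)
    · exact fun y _ => (h2 y).continuousAt.continuousWithinAt
    · exact fun y _ => (h2 y).differentiableAt.differentiableWithinAt
    · rw [hd]
      exact hmono.mono interior_subset
  -- Convexity of `G₁` with `G₁ 0 = 0` makes G₁(y)/y nondecreasing, so `G` is convex as a function
  -- of y².
  have hstar : ∀ {a b : ℝ}, 0 ≤ a → a ≤ b → 0 < b → G₁ a ≤ a / b * G₁ b := by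
    intro a b ha hab hb
    have := hconv.2 (Set.mem_Ici.2 le_rfl) (Set.mem_Ici.2 hb.le)
      (sub_nonneg.2 ((div_le_one hb).2 hab)) (div_nonneg ha hb.le) (by ring)
    simp only [smul_eq_mul, mul_zero, zero_add, h0] at this
    rwa [div_mul_cancel₀ _ hb.ne'] at this
  have hq : ∀ y, HasDerivAt (fun y => G y - G₁ c / (2 * c) * y ^ 2) (G₁ y - G₁ c / c * y) y :=
    fun y => ((h1 y).fun_sub ((hasDerivAt_pow 2 y).const_mul _)).congr_deriv
      (by push_cast; field_simp)
  suffices G c - G₁ c / (2 * c) * c ^ 2 ≤ G x - G₁ c / (2 * c) * x ^ 2 by linarith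
  rcases le_total x c with hxc | hxc
  · have : AntitoneOn (fun y => G y - G₁ c / (2 * c) * y ^ 2) (Set.Icc 0 c) := by
      apply antitoneOn_of_deriv_nonpos (convex_Icc _ _)
      · exact fun y _ => (hq y).continuousAt.continuousWithinAt
      · exact fun y _ => (hq y).differentiableAt.differentiableWithinAt
      · intro y hy
        have hy := interior_subset hy
        rw [(hq y).deriv]
        have := hstar hy.1 hy.2 hc
        have e : y / c * G₁ c = G₁ c / c * y := by ring
        linarith
    exact this ⟨hx, hxc⟩ ⟨hc.le, le_rfl⟩ hxc
  · have : MonotoneOn (fun y => G y - G₁ c / (2 * c) * y ^ 2) (Set.Ici c) := by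
      apply monotoneOn_of_deriv_nonneg (convex_Ici _)
      · exact fun y _ => (hq y).continuousAt.continuousWithinAt
      · exact fun y _ => (hq y).differentiableAt.differentiableWithinAt
      · intro y hy
        have hy : c ≤ y := interior_subset hy
        have hy0 : 0 < y := hc.trans_le hy
        rw [(hq y).deriv]
        have := hstar hc.le hy hy0
        have := mul_le_mul_of_nonneg_left this (div_nonneg hy0.le hc.le)
        have e : y / c * (c / y * G₁ y) = G₁ y := by field_simp
        have e' : y / c * G₁ c = G₁ c / c * y := by ring
        linarith
    exact this (Set.mem_Ici.2 le_rfl) (Set.mem_Ici.2 hxc) hxc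

theorem integral_map_mul {f : ℝ → ℝ} (hf : Continuous f) (μ : Measure ℝ) (c : ℝ) :
    ∫ x, f x ∂(μ.map (c * ·)) = ∫ x, f (c * x) ∂μ :=
  integral_map (by fun_prop) hf.aestronglyMeasurable

instance isProbabilityMeasure_map_mul (μ : Measure ℝ) [IsProbabilityMeasure μ] (c : ℝ) :
    IsProbabilityMeasure (μ.map (c * ·)) :=
  Measure.isProbabilityMeasure_map (by fun_prop)

/-- After smoothing by a centred normal law with standard deviation `τ`, the symmetric two-point
law and the normal law with the same standard deviation `c` are closer to each other. -/
theorem zeta3_gaussian_smoothing_le {τ c : ℝ} (hτ : 0 < τ) (hc : 0 < c) :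
    zeta3 (((gaussianReal 0 1).map (τ * ·)).conv (symTwoPoint c))
        (((gaussianReal 0 1).map (τ * ·)).conv ((gaussianReal 0 1).map (c * ·)))
      ≤ ENNReal.ofReal (1 / (6 * √(2 * Real.pi)) * (c ^ 4 / τ)) := by
  rw [zeta3_comm]
  refine zeta3_le_ofReal fun f hf => ?_
  obtain ⟨hd, hd'⟩ := boundedF3_hasDerivAt hf
  have hL := hf.2.1
  obtain ⟨M, hM⟩ := hf.2.2
  obtain ⟨A, hA, hA'⟩ := exists_bound_derivs hd hd' hL hM
  set γ := gaussianReal 0 1 with hγ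
  set f₁ := deriv f with hf₁
  set f₂ := iteratedDeriv 2 f with hf₂
  have c0 : Continuous f := boundedF3_continuous hf
  have c1 : Continuous f₁ := continuous_iff_continuousAt.2 fun y => (hd' y).continuousAt
  have c2 : Continuous f₂ := hL.continuous
  have iz : Integrable (fun z : ℝ => z) γ := (memLp_gaussian 1 (by norm_num)).integrable le_rfl
  set F : ℝ → ℝ := fun x => ∫ z, f (x + τ * z) ∂γ with hF
  set F₁ : ℝ → ℝ := fun x => ∫ z, f₁ (x + τ * z) ∂γ with hF₁
  set F₂ : ℝ → ℝ := fun x => ∫ z, f₂ (x + τ * z) ∂γ with hF₂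
  set F₃ : ℝ → ℝ := fun x => (∫ z, f₂ (x + τ * z) * z ∂γ) / τ with hF₃
  have d0 : ∀ x, HasDerivAt F (F₁ x) x := fun x => by
    simpa using hasDerivAt_integral_comp_add_mul (μ := γ) (w := fun _ => 1) hd c1 hM hA
      (integrable_const 1) τ x
  have d1 : ∀ x, HasDerivAt F₁ (F₂ x) x := fun x => by
    simpa using hasDerivAt_integral_comp_add_mul (μ := γ) (w := fun _ => 1) hd' c2 hA hA'
      (integrable_const 1) τ x
  -- The second derivative f₂ need not be differentiable. Moving one derivative onto the Gaussian
  -- weight writes F₂ through f₁, so that it can be differentiated once more.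
  have hstein : F₂ = fun x => (∫ z, f₁ (x + τ * z) * z ∂γ) / τ := by
    ext x
    have := integral_deriv_gaussian (u := fun z => f₁ (x + τ * z))
      (u' := fun z => τ * f₂ (x + τ * z)) (A := A) (A' := τ * A)
      (fun z => by
        have := (hd' (x + τ * z)).comp z (((hasDerivAt_id z).const_mul τ).const_add x)
        exact this.congr_deriv (by ring))
      (by fun_prop) (fun z => hA _)
      (fun z => by rw [abs_mul, abs_of_pos hτ]; exact mul_le_mul_of_nonneg_left (hA' _) hτ.le)
    rw [integral_const_mul] at this
    rw [eq_div_iff hτ.ne', ← this, hF₂]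
    ring
  have d2 : ∀ x, HasDerivAt F₂ (F₃ x) x := fun x => by
    rw [hstein]
    exact (hasDerivAt_integral_comp_add_mul hd' c2 hA hA' iz τ x).div_const τ
  set L := √(2 / Real.pi) / τ with hLdef
  have hF₃L : ∀ x y, |F₃ x - F₃ y| ≤ L * |x - y| := fun x y => by
    have int : ∀ x, Integrable (fun z => f₂ (x + τ * z) * z) γ := fun x =>
      iz.bdd_mul (c2.comp (by fun_prop)).aestronglyMeasurable (.of_forall fun z => hA' _)
    rw [hF₃]
    simp only
    rw [← sub_div, abs_div, abs_of_pos hτ, ← integral_sub (int x) (int y), hLdef, div_mul_eq_mul_div]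
    gcongr
    refine (abs_integral_le_integral_abs).trans ?_
    rw [← integral_abs_gaussian, ← integral_mul_const]
    refine integral_mono ((int x).sub' (int y)).abs (iz.abs.mul_const _) fun z => ?_
    simp only
    rw [← sub_mul, abs_mul, mul_comm |z|]
    refine mul_le_mul_of_nonneg_right ?_ (abs_nonneg z)
    simpa [Real.dist_eq] using hL.dist_le_mul (x + τ * z) (y + τ * z)
  -- Subtracting the even part of F from Lx⁴/24 leaves an even function with nonnegative third
  -- derivative on [0, ∞), so it lies above its tangent in x² at c².
  have htan : ∀ x, (L / 24 * c ^ 4 - (F c + F (-c)) / 2)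
      + (L / 6 * c ^ 3 - (F₁ c - F₁ (-c)) / 2) / (2 * c) * (x ^ 2 - c ^ 2)
      ≤ L / 24 * x ^ 4 - (F x + F (-x)) / 2 := fun x => by
    have hpos : ∀ x : ℝ, 0 ≤ x → 0 ≤ L * x - (F₃ x - F₃ (-x)) / 2 := fun x hx => by
      have := (le_abs_self _).trans (hF₃L x (-x))
      rw [sub_neg_eq_add, abs_of_nonneg (by linarith)] at this
      linarith
    have := sq_tangent_le (G := fun x => L / 24 * x ^ 4 - (F x + F (-x)) / 2)
      (G₁ := fun x => L / 6 * x ^ 3 - (F₁ x - F₁ (-x)) / 2)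
      (G₂ := fun x => L / 2 * x ^ 2 - (F₂ x + F₂ (-x)) / 2)
      (G₃ := fun x => L * x - (F₃ x - F₃ (-x)) / 2)
      (fun x => (((hasDerivAt_pow 4 x).const_mul (L / 24)).fun_sub
        (((d0 x).fun_add (hasDerivAt_comp_neg (d0 (-x)))).div_const 2)).congr_deriv
          (by push_cast; ring))
      (fun x => (((hasDerivAt_pow 3 x).const_mul (L / 6)).fun_sub
        (((d1 x).fun_sub (hasDerivAt_comp_neg (d1 (-x)))).div_const 2)).congr_deriv
          (by push_cast; ring))
      (fun x => (((hasDerivAt_pow 2 x).const_mul (L / 2)).fun_sub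
        (((d2 x).fun_add (hasDerivAt_comp_neg (d2 (-x)))).div_const 2)).congr_deriv
          (by push_cast; ring))
      hpos (by simp) hc (abs_nonneg x)
    simp only [sq_abs] at this
    refine this.trans (le_of_eq ?_)
    rcases abs_cases x with ⟨h, -⟩ | ⟨h, -⟩ <;> rw [h]
    rw [neg_neg]; ring
  have hconv : ∀ (Q : Measure ℝ) [IsProbabilityMeasure Q],
      ∫ x, f x ∂((γ.map (τ * ·)).conv Q) = ∫ x, F x ∂Q := fun Q _ => by
    rw [integral_conv_of_mem_boundedF3 hf]
    congr 1 with y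
    rw [integral_map_mul (by fun_prop)]
    simp only [hF, add_comm]
  rw [hconv, hconv, integral_symTwoPoint]
  have cF : Continuous F := continuous_iff_continuousAt.2 fun y => (d0 y).continuousAt
  have hFb : ∀ x, |F x| ≤ M := fun x => by
    have := norm_integral_le_of_norm_le_const (μ := γ) (f := fun z => f (x + τ * z)) (C := M)
      (.of_forall fun z => hM _)
    simpa using this
  rw [integral_map_mul cF]
  have j1 : Integrable (fun x => F (c * x)) γ :=
    .of_bound (cF.comp (by fun_prop)).aestronglyMeasurable M (.of_forall fun x => hFb _)
  have j2 : Integrable (fun x => F (-(c * x))) γ :=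
    .of_bound (cF.comp (by fun_prop)).aestronglyMeasurable M (.of_forall fun x => hFb _)
  have hsymm : ∫ x, F (-(c * x)) ∂γ = ∫ x, F (c * x) ∂γ := by
    have hmap : γ.map (fun x => -x) = γ := by rw [hγ, gaussianReal_map_neg, neg_zero]
    conv_rhs => rw [← hmap]
    rw [integral_map (f := fun x => F (c * x)) (by fun_prop)
      (cF.comp (by fun_prop)).aestronglyMeasurable]
    simp only [mul_neg]
  have i2 : Integrable (fun x : ℝ => x ^ 2) γ :=
    (memLp_gaussian 2 (by norm_num)).integrable_sq
  have i4 : Integrable (fun x : ℝ => x ^ 4) γ := by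
    have := (memLp_gaussian 4 (by norm_num)).integrable_norm_pow (p := 4) (by norm_num)
    refine this.congr (.of_forall fun x => ?_)
    simp only [Real.norm_eq_abs]
    exact (by decide : Even 4).pow_abs x
  obtain ⟨a, ha⟩ : ∃ a, a = L / 24 * c ^ 4 - (F c + F (-c)) / 2 := ⟨_, rfl⟩
  obtain ⟨b, hb⟩ : ∃ b, b = (L / 6 * c ^ 3 - (F₁ c - F₁ (-c)) / 2) / (2 * c) * c ^ 2 := ⟨_, rfl⟩
  -- Integrated against the normal law of variance c², the tangent term vanishes. With E Z⁴ = 3 the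
  -- quartic terms leave (3 - 1)L c⁴/24 = L c⁴/12.
  have hint := integral_mono (μ := γ) (f := fun x => a + b * (x ^ 2 - 1))
    (g := fun x => L / 24 * c ^ 4 * x ^ 4 - (F (c * x) + F (-(c * x))) / 2)
    ((integrable_const a).fun_add ((i2.sub' (integrable_const 1)).const_mul b))
    ((i4.const_mul _).sub' ((j1.fun_add j2).div_const 2)) (fun x => by
      simp only
      refine le_trans (le_of_eq ?_) ((htan (c * x)).trans (le_of_eq ?_))
      · rw [ha, hb]; ring
      · ring)
  rw [integral_add (integrable_const a) ((i2.sub' (integrable_const 1)).const_mul b),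
    integral_const_mul, integral_sub i2 (integrable_const 1),
    integral_sub (i4.const_mul _) ((j1.fun_add j2).div_const 2), integral_const_mul,
    integral_div, integral_add j1 j2, hsymm, hγ, integral_sq_gaussian, integral_pow_four_gaussian,
    ← hγ] at hint
  simp only [integral_const, probReal_univ, smul_eq_mul] at hint
  have hfin : 1 / (6 * √(2 * Real.pi)) * (c ^ 4 / τ) = L / 12 * c ^ 4 := by
    rw [hLdef, ← two_div_sqrt_two_pi]
    have := Real.pi_pos
    field_simp
    norm_num
  rw [hfin]
  linarith

/-! ### Normal approximation of sums of symmetric two-point laws -/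

theorem gaussian_map_mul_conv (a b : ℝ) :
    ((gaussianReal 0 1).map (a * ·)).conv ((gaussianReal 0 1).map (b * ·))
      = (gaussianReal 0 1).map (√(a ^ 2 + b ^ 2) * ·) := by
  rw [gaussianReal_map_const_mul, gaussianReal_map_const_mul, gaussianReal_map_const_mul,
    gaussianReal_conv_gaussianReal]
  congr 1
  · ring
  · ext
    simp [Real.sq_sqrt (by positivity : 0 ≤ a ^ 2 + b ^ 2)]

theorem iterConv_gaussian (a : ℕ → ℝ) (n : ℕ) :
    iterConv (fun i => (gaussianReal 0 1).map (a i * ·)) n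
      = (gaussianReal 0 1).map (√(∑ i ∈ Finset.Icc 1 n, a i ^ 2) * ·) := by
  induction n with
  | zero =>
    simp [iterConv, Measure.map_const]
  | succ n ih =>
    rw [iterConv, ih, gaussian_map_mul_conv, Finset.sum_Icc_succ_top (by omega),
      Real.sq_sqrt (Finset.sum_nonneg fun i _ => sq_nonneg _)]

theorem symTwoPoint_eq_map (c : ℝ) : symTwoPoint c = (symTwoPoint 1).map (c * ·) :=
  (map_symTwoPoint (by fun_prop) (mul_one c) (by ring)).symm

/-- The first k squares are the largest, so their sum is at least k a(k+1)² and, by comparison with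
the overall average, at least k/n. The two bounds give the two entries of the minimum. -/
theorem div_sqrt_sum_sq_le {a : ℕ → ℝ} {n k : ℕ} (ha : ∀ i ∈ Finset.Icc 1 n, 0 < a i)
    (hanti : AntitoneOn a (Set.Icc 1 n)) (hsum : ∑ i ∈ Finset.Icc 1 n, a i ^ 2 = 1)
    (hk : 1 ≤ k) (hkn : k + 1 ≤ n) :
    a (k + 1) / √(∑ i ∈ Finset.Icc 1 k, a i ^ 2) ≤ min 1 (√n * a (k + 1)) / √k := by
  have hpos : 0 < a (k + 1) := ha _ (Finset.mem_Icc.2 ⟨by omega, hkn⟩)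
  have h1 : (k : ℝ) * a (k + 1) ^ 2 ≤ ∑ i ∈ Finset.Icc 1 k, a i ^ 2 := by
    have := Finset.card_nsmul_le_sum (Finset.Icc 1 k) (fun i => a i ^ 2) (a (k + 1) ^ 2)
      fun i hi => by
        rw [Finset.mem_Icc] at hi
        exact pow_le_pow_left₀ hpos.le (hanti ⟨hi.1, by omega⟩ ⟨by omega, hkn⟩ (by omega)) 2
    simpa using this
  have h2 : ∑ i ∈ Finset.Ioc k n, a i ^ 2 ≤ ((n : ℝ) - k) * a (k + 1) ^ 2 := by
    have := Finset.sum_le_card_nsmul (Finset.Ioc k n) (fun i => a i ^ 2) (a (k + 1) ^ 2)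
      fun i hi => by
        rw [Finset.mem_Ioc] at hi
        exact pow_le_pow_left₀ (ha i (Finset.mem_Icc.2 ⟨by omega, hi.2⟩)).le
          (hanti ⟨by omega, hkn⟩ ⟨by omega, hi.2⟩ (by omega)) 2
    rw [Nat.card_Ioc, nsmul_eq_mul, Nat.cast_sub (by omega)] at this
    exact this
  have h3 : ∑ i ∈ Finset.Icc 1 k, a i ^ 2 + ∑ i ∈ Finset.Ioc k n, a i ^ 2 = 1 := by
    have e : ∀ m, Finset.Icc 1 m = Finset.Ioc 0 m := fun m => by
      rw [← Finset.Icc_add_one_left_eq_Ioc, zero_add]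
    rw [← hsum, e, e, Finset.sum_Ioc_consecutive _ (by omega) (by omega)]
  set T := ∑ i ∈ Finset.Icc 1 k, a i ^ 2 with hT
  have hk0 : (0 : ℝ) < k := by exact_mod_cast hk
  have hnk : (0 : ℝ) ≤ (n : ℝ) - k := by
    have : (k : ℝ) ≤ n := by exact_mod_cast (by omega : k ≤ n)
    linarith
  have hT0 : 0 < T := lt_of_lt_of_le (by positivity) h1
  have hkT : (k : ℝ) ≤ n * T := by
    have := mul_le_mul_of_nonneg_left h1 hnk
    have := mul_le_mul_of_nonneg_left h2 hk0.le
    nlinarith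
  have hsT : 0 < √T := Real.sqrt_pos.2 hT0
  have hsk : 0 < √(k : ℝ) := Real.sqrt_pos.2 hk0
  rw [div_le_div_iff₀ hsT hsk, min_mul_of_nonneg _ _ hsT.le]
  refine le_min ?_ ?_
  · rw [one_mul]
    apply Real.le_sqrt_of_sq_le
    rw [mul_pow, Real.sq_sqrt hk0.le]
    linarith
  · have : √(k : ℝ) ≤ √n * √T := by
      rw [← Real.sqrt_mul (Nat.cast_nonneg n)]
      exact Real.sqrt_le_sqrt hkT
    nlinarith

theorem zeta3_iterConv_symTwoPoint_le {a : ℕ → ℝ} {n : ℕ} (hn : 1 ≤ n)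
    (ha : ∀ i ∈ Finset.Icc 1 n, 0 < a i) (hanti : AntitoneOn a (Set.Icc 1 n))
    (hsum : ∑ i ∈ Finset.Icc 1 n, a i ^ 2 = 1) :
    zeta3 (iterConv (fun i => symTwoPoint (a i)) n) (gaussianReal 0 1)
      ≤ ENNReal.ofReal (1 / 6 * (2 * √(2 / Real.pi) - 1) * a 1 ^ 3
        + 1 / (6 * √(2 * Real.pi)) * ∑ k ∈ Finset.Icc 1 (n - 1),
          a (k + 1) ^ 3 * min 1 (√n * a (k + 1)) / √k) := by
  have ha1 : 0 < a 1 := ha 1 (by simp [hn])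
  have hG : gaussianReal 0 1 = iterConv (fun i => (gaussianReal 0 1).map (a i * ·)) n := by
    rw [iterConv_gaussian, hsum]
    simp
  have h0 : 0 ≤ 2 * √(2 / Real.pi) - 1 := by
    have : (1 / 2 : ℝ) ≤ √(2 / Real.pi) := by
      apply Real.le_sqrt_of_sq_le
      rw [le_div_iff₀ Real.pi_pos]
      linarith [Real.pi_le_four]
    linarith
  have hterm : ∀ k ∈ Finset.Icc 1 (n - 1), 0 ≤ a (k + 1) ^ 3 * min 1 (√n * a (k + 1)) / √k := by
    intro k hk
    rw [Finset.mem_Icc] at hk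
    have := ha (k + 1) (Finset.mem_Icc.2 ⟨by omega, by omega⟩)
    positivity
  conv_lhs => rw [hG]
  refine (zeta3_iterConv_le_sum (fun _ _ => inferInstance) (fun _ _ => inferInstance)).trans ?_
  obtain ⟨m, rfl⟩ : ∃ m, n = m + 1 := ⟨n - 1, by omega⟩
  -- The index 0 term has no Gaussian factor to smooth it and is split off; it produces the a(1)³
  -- summand. Every other term is c⁴/τ = c³ · (c/τ), with c = a(k+1) and τ² the sum of the first k
  -- squares.
  rw [Finset.sum_range_succ', add_comm]
  simp only [Nat.add_sub_cancel] at hterm ⊢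
  rw [ENNReal.ofReal_add (by positivity)
    (mul_nonneg (by positivity) (Finset.sum_nonneg hterm))]
  refine add_le_add ?_ ?_
  · simp only [iterConv, zero_add]
    rw [Measure.dirac_zero_conv, Measure.dirac_zero_conv, symTwoPoint_eq_map]
    refine (zeta3_map_mul_le _ _ ha1).trans ?_
    refine (mul_le_mul_right zeta3_symTwoPoint_gaussian_le _).trans (le_of_eq ?_)
    rw [← ENNReal.ofReal_mul (by positivity), mul_comm]
  · rw [Finset.mul_sum, ENNReal.ofReal_sum_of_nonneg
      (fun k hk => mul_nonneg (by positivity) (hterm k hk)),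
      ← Finset.Ico_add_one_right_eq_Icc, Finset.sum_Ico_eq_sum_range]
    simp only [Nat.add_sub_cancel]
    refine Finset.sum_le_sum fun j hj => ?_
    rw [Finset.mem_range] at hj
    rw [add_comm 1 j, iterConv_gaussian]
    have hp : 0 < a (j + 1 + 1) := ha _ (Finset.mem_Icc.2 ⟨by omega, by omega⟩)
    have hT : 0 < ∑ i ∈ Finset.Icc 1 (j + 1), a i ^ 2 :=
      Finset.sum_pos (fun i hi => pow_pos (ha i (Finset.Icc_subset_Icc_right (by omega) hi)) 2)
        ⟨1, by simp⟩
    refine (zeta3_gaussian_smoothing_le (Real.sqrt_pos.2 hT) hp).trans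
      (ENNReal.ofReal_le_ofReal ?_)
    have := mul_le_mul_of_nonneg_left
      (div_sqrt_sum_sq_le (k := j + 1) ha hanti hsum (by omega) (by omega))
      (pow_nonneg hp.le 3)
    refine mul_le_mul_of_nonneg_left (le_trans (le_of_eq ?_) (this.trans (le_of_eq ?_)))
      (by positivity)
    · ring
    · ring

/-! ### Standardized laws -/

theorem NondegenerateL3.memLp {P : Measure ℝ} (hP : NondegenerateL3 P) :
    MemLp (fun x => x) 3 P := by
  have := hP.integrable_abs_cube
  rw [← integrable_norm_rpow_iff (by fun_prop) (by norm_num) (by norm_num)]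
  simpa using this

theorem NondegenerateL3.standardize_facts {P : Measure ℝ} (hP : NondegenerateL3 P) :
    IsProbabilityMeasure (standardize P) ∧ MemLp (fun x => x) 3 (standardize P) ∧
      ∫ x, x ∂(standardize P) = 0 ∧ ∫ x, x ^ 2 ∂(standardize P) = 1 ∧
      ∫ x, |x| ^ 3 ∂(standardize P) = rho P := by
  have := hP.isProbabilityMeasure
  have hs := hP.stdDev_pos
  have h3 := hP.memLp
  have h1 : Integrable (fun x : ℝ => x) P := h3.integrable (by norm_num)
  have hm : Measurable fun x : ℝ => (x - mean P) / stdDev P := by fun_prop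
  refine ⟨Measure.isProbabilityMeasure_map hm.aemeasurable, ?_, ?_, ?_, ?_⟩
  · refine (memLp_map_measure_iff (by fun_prop) hm.aemeasurable).2 ?_
    have := (h3.sub (memLp_const (mean P))).const_mul (stdDev P)⁻¹
    refine this.ae_eq (.of_forall fun x => ?_)
    simp [div_eq_inv_mul]
  · rw [standardize, integral_map hm.aemeasurable (by fun_prop), integral_div,
      integral_sub h1 (integrable_const _)]
    simp [mean]
  · rw [standardize, integral_map hm.aemeasurable (by fun_prop)]
    simp only [div_pow]
    have hv : variance (fun x => x) P = ∫ x, (x - mean P) ^ 2 ∂P :=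
      variance_eq_integral (by fun_prop)
    rw [integral_div, ← hv, stdDev, Real.sq_sqrt (variance_nonneg _ _), div_self]
    exact (Real.sqrt_pos.1 hs).ne'
  · rw [standardize, integral_map hm.aemeasurable (by fun_prop), rho]

theorem zeta3_scaled_le {P : Measure ℝ} (hP : NondegenerateL3 P) {s : ℝ} (hs : 0 < s) :
    zeta3 (P.map fun x => (x - mean P) / s) (symTwoPoint (stdDev P / s))
      ≤ ENNReal.ofReal ((stdDev P / s) ^ 3 * (B (rho P) / 6)) := by
  obtain ⟨hp, h3, m1, m2, m3⟩ := hP.standardize_facts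
  have hσ := hP.stdDev_pos
  have e : (P.map fun x => (x - mean P) / s) = (standardize P).map (stdDev P / s * ·) := by
    rw [standardize, Measure.map_map (by fun_prop) (by fun_prop)]
    congr 1
    ext x
    simp only [Function.comp]
    field_simp
  rw [e, symTwoPoint_eq_map, ENNReal.ofReal_mul (by positivity), ← m3]
  exact (zeta3_map_mul_le _ _ (by positivity)).trans
    (mul_le_mul_right (zeta3_symTwoPoint_le h3 m1 m2) _)

theorem standardize_iterConv_symTwoPoint {σ : ℕ → ℝ} {n : ℕ}
    (hσ : ∀ i ∈ Finset.Icc 1 n, 0 < σ i) :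
    standardize (iterConv (fun i => symTwoPoint (σ i)) n)
      = iterConv (fun i => symTwoPoint (σ i / √(∑ i ∈ Finset.Icc 1 n, σ i ^ 2))) n := by
  rw [standardize_iterConv (fun _ _ => inferInstance) (fun _ _ => memLp_symTwoPoint _ _)]
  congr 1
  ext1 i
  rw [mean_symTwoPoint, Finset.sum_congr rfl fun i hi => by rw [stdDev_symTwoPoint (hσ i hi).le]]
  exact map_symTwoPoint (by fun_prop) (by simp) (by simp [neg_div])

/-! ### Numerical values of the constants -/

/-- The rounding is chosen so that (2 · 0.7979 - 1)/6 = 0.0993 exactly, while 0.7979/12 < 0.0665. -/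
theorem sqrt_two_div_pi_le : √(2 / Real.pi) ≤ 0.7979 := by
  apply Real.sqrt_le_iff.2 ⟨by norm_num, ?_⟩
  rw [div_le_iff₀ Real.pi_pos]
  linarith [Real.pi_gt_d6]

theorem numeric_bound {a : ℝ} (ha : 0 ≤ a) {t u : ℕ → ℝ} {S : Finset ℕ}
    (h : ∀ k ∈ S, t k ≤ u k) (hu : ∀ k ∈ S, 0 ≤ u k) :
    1 / 6 * (2 * √(2 / Real.pi) - 1) * a + 1 / (6 * √(2 * Real.pi)) * ∑ k ∈ S, t k
      ≤ 0.0993 * a + 0.0665 * ∑ k ∈ S, u k := by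
  have h1 := sqrt_two_div_pi_le
  have h2 : 1 / (6 * √(2 * Real.pi)) = √(2 / Real.pi) / 12 := by
    rw [← two_div_sqrt_two_pi]
    have := Real.pi_pos
    field_simp
    norm_num
  rw [h2]
  refine add_le_add (mul_le_mul_of_nonneg_right (by linarith) ha) ?_
  exact (mul_le_mul_of_nonneg_left (Finset.sum_le_sum h) (by positivity)).trans
    (mul_le_mul_of_nonneg_right (by linarith) (Finset.sum_nonneg hu))

end ZolotarevCLT

/-! ### Assembly of the three inequalities -/

theorem theorem1p15 (n : ℕ) (hn : 1 ≤ n) (P Q : ℕ → Measure ℝ)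
    (hP : ∀ i ∈ Finset.Icc 1 n, ZolotarevCLT.NondegenerateL3 (P i))
    (σ ρ : ℕ → ℝ) (s : ℝ)
    (hσ : ∀ i, σ i = ZolotarevCLT.stdDev (P i))
    (hρ : ∀ i, ρ i = ZolotarevCLT.rho (P i))
    (hQ : ∀ i, Q i = ZolotarevCLT.symTwoPoint (σ i))
    (hs : s = √(∑ i ∈ Finset.Icc 1 n, σ i ^ 2)) :
    ZolotarevCLT.zeta3 (ZolotarevCLT.standardize (ZolotarevCLT.iterConv P n)) (gaussianReal 0 1)
        ≤ ENNReal.ofReal (1 / (6 * s ^ 3) *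
              ∑ i ∈ Finset.Icc 1 n, σ i ^ 3 * ZolotarevCLT.B (ρ i))
          + ZolotarevCLT.zeta3 (ZolotarevCLT.standardize (ZolotarevCLT.iterConv Q n))
              (gaussianReal 0 1)
    ∧ (AntitoneOn σ (Set.Icc 1 n) →
        ZolotarevCLT.zeta3 (ZolotarevCLT.standardize (ZolotarevCLT.iterConv Q n))
            (gaussianReal 0 1)
          ≤ ENNReal.ofReal (1 / 6 * (2 * √(2 / Real.pi) - 1) * (σ 1 ^ 3 / s ^ 3)
              + 1 / (6 * √(2 * Real.pi)) *
                ∑ k ∈ Finset.Icc 1 (n - 1),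
                  σ (k + 1) ^ 3 * min 1 (√(n : ℝ) * σ (k + 1) / s) / (s ^ 3 * √(k : ℝ)))
        ∧ 1 / 6 * (2 * √(2 / Real.pi) - 1) * (σ 1 ^ 3 / s ^ 3)
              + 1 / (6 * √(2 * Real.pi)) *
                ∑ k ∈ Finset.Icc 1 (n - 1),
                  σ (k + 1) ^ 3 * min 1 (√(n : ℝ) * σ (k + 1) / s) / (s ^ 3 * √(k : ℝ))
          ≤ 0.0993 * (σ 1 ^ 3 / s ^ 3)
              + 0.0665 * ∑ k ∈ Finset.Icc 1 (n - 1), σ (k + 1) ^ 3 / (s ^ 3 * √(k : ℝ))) := by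
  have hσ0 : ∀ i ∈ Finset.Icc 1 n, 0 < σ i := fun i hi => hσ i ▸ (hP i hi).stdDev_pos
  have hsum0 : 0 < ∑ i ∈ Finset.Icc 1 n, σ i ^ 2 :=
    Finset.sum_pos (fun i hi => pow_pos (hσ0 i hi) 2) ⟨1, by simp [hn]⟩
  have hs0 : 0 < s := hs ▸ Real.sqrt_pos.2 hsum0
  have hs2 : s ^ 2 = ∑ i ∈ Finset.Icc 1 n, σ i ^ 2 := hs ▸ Real.sq_sqrt hsum0.le
  have hQe : ZolotarevCLT.standardize (ZolotarevCLT.iterConv Q n) = ZolotarevCLT.iterConv (fun i => ZolotarevCLT.symTwoPoint (σ i / s)) n := by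
    rw [show Q = fun i => ZolotarevCLT.symTwoPoint (σ i) from funext hQ, ZolotarevCLT.standardize_iterConv_symTwoPoint hσ0, hs]
  have hPp : ∀ i ∈ Finset.Icc 1 n, IsProbabilityMeasure (P i) :=
    fun i hi => (hP i hi).isProbabilityMeasure
  refine ⟨?_, fun hanti => ⟨?_, ?_⟩⟩
  -- Both standardized convolutions use the same scale s and are convolutions of rescaled summands,
  -- so the replacement bound applies term by term with factor (σ i / s)³.
  · refine (ZolotarevCLT.zeta3_triangle _ (ZolotarevCLT.standardize (ZolotarevCLT.iterConv Q n)) _).trans (add_le_add ?_ le_rfl)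
    rw [hQe, ZolotarevCLT.standardize_iterConv hPp
      (fun i hi => have := hPp i hi; (hP i hi).memLp.mono_exponent (by norm_num))]
    simp only [← hσ]
    rw [← hs]
    refine (ZolotarevCLT.zeta3_iterConv_le_sum_zeta3
      (fun i hi => have := hPp i hi; Measure.isProbabilityMeasure_map (by fun_prop))
      (fun _ _ => inferInstance)).trans ?_
    rw [Finset.mul_sum, ENNReal.ofReal_sum_of_nonneg fun i hi => mul_nonneg (by positivity)
      (mul_nonneg (pow_nonneg (hσ0 i hi).le 3) (ZolotarevCLT.B_nonneg _))]
    refine Finset.sum_le_sum fun i hi => ?_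
    have := ZolotarevCLT.zeta3_scaled_le (hP i hi) hs0
    rw [← hσ, ← hρ] at this
    refine this.trans (le_of_eq (congr_arg _ ?_))
    field_simp
  · rw [hQe]
    refine (ZolotarevCLT.zeta3_iterConv_symTwoPoint_le (a := fun i => σ i / s) hn
      (fun i hi => div_pos (hσ0 i hi) hs0)
      (fun i hi j hj hij => div_le_div_of_nonneg_right (hanti hi hj hij) hs0.le)
      (by simp only [div_pow]; rw [← Finset.sum_div, ← hs2, div_self (by positivity)])).trans
      (le_of_eq (congr_arg _ ?_))
    simp only [div_pow, mul_div_assoc]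
    congr 2
    refine Finset.sum_congr rfl fun k _ => ?_
    rw [div_mul_div_comm, mul_div_assoc]
  · refine ZolotarevCLT.numeric_bound (div_nonneg (pow_nonneg (hσ0 1 (by simp [hn])).le 3) (by positivity))
      (fun k hk => ?_) (fun k hk => ?_)
    all_goals
      rw [Finset.mem_Icc] at hk
      have hk0 := hσ0 (k + 1) (Finset.mem_Icc.2 ⟨by omega, by omega⟩)
    · gcongr
      exact mul_le_of_le_one_right (by positivity) (min_le_left _ _)
    · positivity
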